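/- **Setting.** Let $q:\mathbb R\to\mathbb R$ be continuous and piecewise continuously differentiable (i.e. continuously differentiable off a set of break points having finitely many points in every bounded interval), and suppose that $q^2$ and $q'$ belong to $\mathcal L_{1,1}(\mathbb R)$, where $f\in\mathcal L_{1,1}(\mathbb R)$ means $\int_{-\infty}^{\infty}(1+|x|)\,|f(x)|\,dx<\infty$. For $\operatorname{Im}\rho\ge 0$ let $\varphi(\rho,x)=(\varphi_1,\varphi_2)^T$ and $\psi(\rho,x)=(\psi_1,\psi_2)^T$ be the Jost solutions of the Zakharov–Shabat system $$n_1'+i\rho n_1=q\,n_2,\qquad n_2'-i\rho n_2=-q\,n_1,$$ that is, the solutions with $\varphi(\rho,x)\,e^{i\rho x}\to(1,0)^T$ as $x\to-\infty$ and $\psi(\rho,x)\,e^{-i\rho x}\to(0,1)^T$ as $x\to+\infty$. Put $q_1:=-iq'-q^2$, and let $e(\rho,x)\sim e^{i\rho x}$ ($x\to+\infty$) and $g(\rho,x)\sim e^{-i\rho x}$ ($x\to-\infty$) be the Jost solutions of $-y''+q_1y=\rho^2y$. Let $A(x,\cdot)\in L_2(x,\infty)$ and $B(x,\cdot)\in L_2(-\infty,x)$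 be the kernels of their integral representations $$e(\rho,x)=e^{i\rho x}+\int_x^\infty A(x,t)e^{i\rho t}\,dt,\qquad g(\rho,x)=e^{-i\rho x}+\int_{-\infty}^x B(x,t)e^{-i\rho t}\,dt\qquad(\operatorname{Im}\rho>0),$$ and let $a_n(x)$, $b_n(x)$ be their Fourier–Laguerre coefficients, $$a_n(x)=\int_x^\infty A(x,t)L_n(t-x)e^{-\frac{t-x}2}\,dt,\qquad b_n(x)=\int_{-\infty}^xB(x,t)L_n(x-t)e^{-\frac{x-t}2}\,dt,$$ with $L_n$ the Laguerre polynomial of degree $n$. With $z=z(\rho)=\dfrac{\frac12+i\rho}{\frac12-i\rho}$ and $N=0,1,2,\dots$ define the partial sums $$\varphi_{1,N}=e^{-i\rho x}\Bigl(1+(z+1)\sum_{n=0}^N(-1)^nz^n\operatorname{Re}b_n(x)\Bigr),\qquad \varphi_{2,N}=e^{-i\rho x}(z+1)\sum_{n=0}^N(-1)^nz^n\operatorname{Im}b_n(x),$$ $$\psi_{1,N}=-e^{i\rho x}(z+1)\sum_{n=0}^N(-1)^nz^n\operatorname{Im}a_n(x),\qquad \psi_{2,N}=e^{i\rho x}\Bigl(1+(z+1)\sum_{n=0}^N(-1)^nz^n\operatorname{Re}a_n(x)\Bigr).$$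 **Theorem.** For every $x\in\mathbb R$ the series $\sum_n|a_n(x)|^2$ and $\sum_n|b_n(x)|^2$ converge, and with $$\varepsilon_N(x):=\Bigl(\sum_{n=N+1}^\infty|b_n(x)|^2\Bigr)^{1/2},\qquad \delta_N(x):=\Bigl(\sum_{n=N+1}^\infty|a_n(x)|^2\Bigr)^{1/2}$$ the following holds for all $N\ge0$. (1) If $\operatorname{Im}\rho>0$, then for $j=1,2$ $$|\varphi_j(\rho,x)-\varphi_{j,N}(\rho,x)|\le\varepsilon_N(x)\,\frac{e^{\operatorname{Im}\rho\,x}}{\sqrt{2\operatorname{Im}\rho}},\qquad |\psi_j(\rho,x)-\psi_{j,N}(\rho,x)|\le\delta_N(x)\,\frac{e^{-\operatorname{Im}\rho\,x}}{\sqrt{2\operatorname{Im}\rho}}.$$ (2) For $j=1,2$ the remainders, as functions of $\rho\in\mathbb R$, belong to $L_2(-\infty,\infty)$ and $$\|\varphi_j(\cdot,x)-\varphi_{j,N}(\cdot,x)\|_{L_2(-\infty,\infty)}\le\sqrt{2\pi}\,\varepsilon_N(x),\qquad \|\psi_j(\cdot,x)-\psi_{j,N}(\cdot,x)\|_{L_2(-\infty,\infty)}\le\sqrt{2\pi}\,\delta_N(x).$$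 -/

import Mathlib

open MeasureTheory Filter Topology Set

noncomputable section

namespace ZS

/-- Piecewise continuously differentiable potentials: `q` is continuous on the line and of class
`C¹` near every point outside a set `S` of break points which is finite in each bounded interval.
(Existence of one-sided limits of `q'` at the break points is not required, so that every usual
convention is covered.) -/
def PiecewiseC1 (q : ℝ → ℝ) : Prop :=
  Continuous q ∧
    ∃ S : Set ℝ, (∀ R : ℝ, (S ∩ Icc (-R) R).Finite) ∧ ∀ x, x ∉ S → ContDiffAt ℝ 1 q x

/-- The class `𝓛_{1,1}(-∞,∞)`: measurable functions with `∫ (1 + |x|) |f x| dx < ∞`. -/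
def ClassL11 {E : Type*} [NormedAddCommGroup E] (f : ℝ → E) : Prop :=
  AEStronglyMeasurable f volume ∧ Integrable (fun x : ℝ => (1 + |x|) * ‖f x‖) volume

/-- `(n₁, n₂)` solves the Zakharov-Shabat system `n₁' + iρ n₁ = q n₂`, `n₂' - iρ n₂ = -q n₁`
on the whole line. -/
def IsZSSolution (q : ℝ → ℝ) (ρ : ℂ) (n₁ n₂ : ℝ → ℂ) : Prop :=
  (∀ x : ℝ, HasDerivAt n₁ (-(Complex.I * ρ) * n₁ x + (q x : ℂ) * n₂ x) x) ∧
    ∀ x : ℝ, HasDerivAt n₂ (Complex.I * ρ * n₂ x - (q x : ℂ) * n₁ x) x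

/-- The left Jost solution of the Zakharov-Shabat system:
`(φ₁, φ₂) ∼ (1, 0) e^{-iρx}` as `x → -∞`. -/
def IsLeftJostZS (q : ℝ → ℝ) (ρ : ℂ) (φ₁ φ₂ : ℝ → ℂ) : Prop :=
  IsZSSolution q ρ φ₁ φ₂ ∧
    Tendsto (fun x : ℝ => φ₁ x * Complex.exp (Complex.I * ρ * x)) atBot (𝓝 1) ∧
    Tendsto (fun x : ℝ => φ₂ x * Complex.exp (Complex.I * ρ * x)) atBot (𝓝 0)

/-- The right Jost solution of the Zakharov-Shabat system:
`(ψ₁, ψ₂) ∼ (0, 1) e^{iρx}` as `x → ∞`. -/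
def IsRightJostZS (q : ℝ → ℝ) (ρ : ℂ) (ψ₁ ψ₂ : ℝ → ℂ) : Prop :=
  IsZSSolution q ρ ψ₁ ψ₂ ∧
    Tendsto (fun x : ℝ => ψ₁ x * Complex.exp (-(Complex.I * ρ * x))) atTop (𝓝 0) ∧
    Tendsto (fun x : ℝ => ψ₂ x * Complex.exp (-(Complex.I * ρ * x))) atTop (𝓝 1)

/-- `y` is a (Carathéodory) solution of `-y'' + Q y = ρ² y` on the line: `y` is differentiable and
`y'` is an indefinite integral of `(Q - ρ²) y`. -/
def IsSchrSolution (Q : ℝ → ℂ) (ρ : ℂ) (y : ℝ → ℂ) : Prop :=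
  ∃ dy : ℝ → ℂ, (∀ x : ℝ, HasDerivAt y (dy x) x) ∧
    ∀ a b : ℝ, IntervalIntegrable (fun t => (Q t - ρ ^ 2) * y t) volume a b ∧
      dy b - dy a = ∫ t in a..b, (Q t - ρ ^ 2) * y t

/-- The Jost solution `e(ρ, ·) ∼ e^{iρx}`, `x → ∞`, of the Schrödinger equation. -/
def IsRightJostSchr (Q : ℝ → ℂ) (ρ : ℂ) (e : ℝ → ℂ) : Prop :=
  IsSchrSolution Q ρ e ∧
    Tendsto (fun x : ℝ => e x * Complex.exp (-(Complex.I * ρ * x))) atTop (𝓝 1)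

/-- The Jost solution `g(ρ, ·) ∼ e^{-iρx}`, `x → -∞`, of the Schrödinger equation. -/
def IsLeftJostSchr (Q : ℝ → ℂ) (ρ : ℂ) (g : ℝ → ℂ) : Prop :=
  IsSchrSolution Q ρ g ∧
    Tendsto (fun x : ℝ => g x * Complex.exp (Complex.I * ρ * x)) atBot (𝓝 1)

/-- `K = A(x, ·) ∈ L₂(x, ∞)` is the kernel of the Levin representation
`e(ρ, x) = e^{iρx} + ∫_x^∞ A(x, t) e^{iρt} dt`. For `Im ρ > 0` the integral of an `L₂` function
against `e^{iρt}` converges absolutely, and these values of `ρ` determine `K` almost everywhere. -/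
def IsRightLevinKernel (Q : ℝ → ℂ) (x : ℝ) (K : ℝ → ℂ) : Prop :=
  MemLp K 2 (volume.restrict (Ioi x)) ∧
    ∀ ρ : ℂ, 0 < ρ.im → ∀ e : ℝ → ℂ, IsRightJostSchr Q ρ e →
      e x = Complex.exp (Complex.I * ρ * x)
        + ∫ t in Ioi x, K t * Complex.exp (Complex.I * ρ * t)

/-- `K = B(x, ·) ∈ L₂(-∞, x)` is the kernel of the Levin representation
`g(ρ, x) = e^{-iρx} + ∫_{-∞}^x B(x, t) e^{-iρt} dt`. -/
def IsLeftLevinKernel (Q : ℝ → ℂ) (x : ℝ) (K : ℝ → ℂ) : Prop :=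
  MemLp K 2 (volume.restrict (Iio x)) ∧
    ∀ ρ : ℂ, 0 < ρ.im → ∀ g : ℝ → ℂ, IsLeftJostSchr Q ρ g →
      g x = Complex.exp (-(Complex.I * ρ * x))
        + ∫ t in Iio x, K t * Complex.exp (-(Complex.I * ρ * t))

/-- The kernel `A(x, ·)` of the right Levin representation. -/
def rightLevinKernel (Q : ℝ → ℂ) (x : ℝ) : ℝ → ℂ :=
  Classical.epsilon (IsRightLevinKernel Q x)

/-- The kernel `B(x, ·)` of the left Levin representation. -/
def leftLevinKernel (Q : ℝ → ℂ) (x : ℝ) : ℝ → ℂ :=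
  Classical.epsilon (IsLeftLevinKernel Q x)

/-- The Laguerre polynomial `L_n(t) = ∑_{k=0}^n (n choose k) (-t)^k / k!`. -/
def laguerre (n : ℕ) (t : ℝ) : ℝ :=
  ∑ k ∈ Finset.range (n + 1), (n.choose k : ℝ) * (-t) ^ k / (k.factorial : ℝ)

/-- The Fourier-Laguerre coefficients of `A(x, ·)`, that is, the coefficients of
`A(x, t) = ∑ a_n(x) L_n(t - x) e^{(x - t)/2}`. -/
def laguerreA (Q : ℝ → ℂ) (n : ℕ) (x : ℝ) : ℂ :=
  ∫ t in Ioi x, rightLevinKernel Q x t * ((laguerre n (t - x) * Real.exp ((x - t) / 2) : ℝ) : ℂ)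

/-- The Fourier-Laguerre coefficients of `B(x, ·)`, that is, the coefficients of
`B(x, t) = ∑ b_n(x) L_n(x - t) e^{-(x - t)/2}`. -/
def laguerreB (Q : ℝ → ℂ) (n : ℕ) (x : ℝ) : ℂ :=
  ∫ t in Iio x, leftLevinKernel Q x t * ((laguerre n (x - t) * Real.exp (-(x - t) / 2) : ℝ) : ℂ)

/-- The potential `q₁ = -i q' - q²` of the Schrödinger equation satisfied by `n₁ + i n₂`. -/
def schrPotential (q : ℝ → ℝ) (x : ℝ) : ℂ :=
  -(Complex.I * ((deriv q x : ℝ) : ℂ)) - ((q x : ℝ) : ℂ) ^ 2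

/-- The SPPS coefficients `a_n(x)` of the Zakharov-Shabat system. -/
def coeffA (q : ℝ → ℝ) (n : ℕ) (x : ℝ) : ℂ := laguerreA (schrPotential q) n x

/-- The SPPS coefficients `b_n(x)` of the Zakharov-Shabat system. -/
def coeffB (q : ℝ → ℝ) (n : ℕ) (x : ℝ) : ℂ := laguerreB (schrPotential q) n x

/-- The Möbius parameter `z(ρ) = (1/2 + iρ) / (1/2 - iρ)`. -/
def zParam (ρ : ℂ) : ℂ := (1 / 2 + Complex.I * ρ) / (1 / 2 - Complex.I * ρ)

/-- The factor `(z + 1) ∑_{n=0}^N (-1)^n z^n c_n`, `z = z(ρ)`, for real coefficients `c_n`. -/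
def sppsSum (c : ℕ → ℝ) (N : ℕ) (ρ : ℂ) : ℂ :=
  (zParam ρ + 1) * ∑ n ∈ Finset.range (N + 1), (-1) ^ n * zParam ρ ^ n * (c n : ℂ)

/-- The partial sum `φ_{1,N}(ρ, x)`. -/
def phi1N (q : ℝ → ℝ) (N : ℕ) (ρ : ℂ) (x : ℝ) : ℂ :=
  Complex.exp (-(Complex.I * ρ * x)) * (1 + sppsSum (fun n => (coeffB q n x).re) N ρ)

/-- The partial sum `φ_{2,N}(ρ, x)`. -/
def phi2N (q : ℝ → ℝ) (N : ℕ) (ρ : ℂ) (x : ℝ) : ℂ :=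
  Complex.exp (-(Complex.I * ρ * x)) * sppsSum (fun n => (coeffB q n x).im) N ρ

/-- The partial sum `ψ_{1,N}(ρ, x)`. -/
def psi1N (q : ℝ → ℝ) (N : ℕ) (ρ : ℂ) (x : ℝ) : ℂ :=
  -(Complex.exp (Complex.I * ρ * x) * sppsSum (fun n => (coeffA q n x).im) N ρ)

/-- The partial sum `ψ_{2,N}(ρ, x)`. -/
def psi2N (q : ℝ → ℝ) (N : ℕ) (ρ : ℂ) (x : ℝ) : ℂ :=
  Complex.exp (Complex.I * ρ * x) * (1 + sppsSum (fun n => (coeffA q n x).re) N ρ)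

/-- The `ℓ₂` tail `(∑_{n=N+1}^∞ |c_n|²)^{1/2}`. -/
def tailNorm (c : ℕ → ℂ) (N : ℕ) : ℝ :=
  Real.sqrt (∑' n : ℕ, ‖c (N + 1 + n)‖ ^ 2)

end ZS

end

noncomputable section

namespace ZS

section Plancherel

open FourierTransform SchwartzMap
open scoped ContDiff

theorem coeFn_fourier_toLp_ae_eq {f : ℝ → ℂ} (h1 : Integrable f) (h2 : MemLp f 2) :
    ((𝓕 (h2.toLp f) : Lp ℂ 2 (volume : Measure ℝ)) : ℝ → ℂ) =ᵐ[volume] 𝓕 f := by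
  set F : Lp ℂ 2 (volume : Measure ℝ) := 𝓕 (h2.toLp f) with hF
  have hc : Continuous (𝓕 f) :=
    VectorFourier.fourierIntegral_continuous Real.continuous_fourierChar
      (by exact continuous_inner) h1
  have hloc1 : LocallyIntegrable (F : ℝ → ℂ) volume :=
    (Lp.memLp F).locallyIntegrable (by norm_num)
  refine ae_eq_of_integral_contDiff_smul_eq hloc1 hc.locallyIntegrable ?_
  intro g g_smooth g_cpt
  have hg₁ : HasCompactSupport (Complex.ofRealCLM ∘ g) := g_cpt.comp_left rfl
  have hg₂ : ContDiff ℝ ∞ (Complex.ofRealCLM ∘ g) := by fun_prop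
  set G : 𝓢(ℝ, ℂ) := hg₁.toSchwartzMap hg₂ with hG
  have hGg : ∀ x, G x = (g x : ℂ) := fun x => rfl
  have key : (𝓕 ((h2.toLp f : Lp ℂ 2 (volume : Measure ℝ)) : 𝓢'(ℝ, ℂ))) G
      = (F : 𝓢'(ℝ, ℂ)) G := by
    rw [Lp.fourier_toTemperedDistribution_eq]
  rw [TemperedDistribution.fourier_apply, Lp.toTemperedDistribution_apply,
    Lp.toTemperedDistribution_apply] at key
  have e1 : ∫ x, (𝓕 G) x • (h2.toLp f : ℝ → ℂ) x = ∫ x, (𝓕 G) x • f x := by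
    apply integral_congr_ae
    filter_upwards [h2.coeFn_toLp] with x hx
    rw [hx]
  have e2 : ∫ x, (𝓕 (G : ℝ → ℂ)) x • f x = ∫ x, G x • (𝓕 f) x := by
    have := VectorFourier.integral_fourierIntegral_smul_eq_flip (μ := volume) (ν := volume)
      (L := innerₗ ℝ) (f := (G : ℝ → ℂ)) (g := f) Real.continuous_fourierChar
      (by exact continuous_inner) G.integrable h1
    rw [flip_innerₗ] at this
    exact this
  have e3 (h : ℝ → ℂ) : ∫ x, g x • h x = ∫ x, G x • h x := rfl
  rw [e3, e3, ← key, e1, ← e2, SchwartzMap.fourier_coe]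

theorem memLp_fourier {f : ℝ → ℂ} (h1 : Integrable f) (h2 : MemLp f 2) : MemLp (𝓕 f) 2 :=
  (Lp.memLp (𝓕 (h2.toLp f))).ae_eq (coeFn_fourier_toLp_ae_eq h1 h2)

theorem eLpNorm_fourier {f : ℝ → ℂ} (h1 : Integrable f) (h2 : MemLp f 2) :
    eLpNorm (𝓕 f) 2 volume = eLpNorm f 2 volume := by
  rw [← eLpNorm_congr_ae (coeFn_fourier_toLp_ae_eq h1 h2), ← eLpNorm_congr_ae h2.coeFn_toLp,
    ← Lp.enorm_def, ← Lp.enorm_def, ← ofReal_norm, ← ofReal_norm, Lp.norm_fourier_eq]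

end Plancherel

/-- The half-line transform `∫_0^∞ f(s) e^{iρs} ds`. -/
def halfLineTransform (f : ℝ → ℂ) (ρ : ℂ) : ℂ :=
  ∫ s in Ioi (0 : ℝ), f s * Complex.exp (Complex.I * ρ * s)

theorem halfLineTransform_ofReal (f : ℝ → ℂ) (ξ : ℝ) :
    halfLineTransform f (ξ : ℂ)
      = FourierTransform.fourier ((Ioi (0 : ℝ)).indicator f) ((-(2 * Real.pi)⁻¹) * ξ) := by
  rw [halfLineTransform, Real.fourier_eq', ← integral_indicator measurableSet_Ioi]
  congr 1
  ext s
  by_cases hs : s ∈ Ioi (0 : ℝ)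
  · simp only [indicator_of_mem hs, smul_eq_mul]
    rw [mul_comm]
    congr 2
    simp only [RCLike.inner_apply, conj_trivial]
    push_cast
    field_simp
  · simp [indicator_of_notMem hs]

theorem memLp_eLpNorm_halfLineTransform {f : ℝ → ℂ} (h1 : IntegrableOn f (Ioi 0))
    (h2 : MemLp f 2 (volume.restrict (Ioi 0))) :
    MemLp (fun ξ : ℝ => halfLineTransform f (ξ : ℂ)) 2 volume ∧
      eLpNorm (fun ξ : ℝ => halfLineTransform f (ξ : ℂ)) 2 volume
        = ENNReal.ofReal (Real.sqrt (2 * Real.pi)) * eLpNorm f 2 (volume.restrict (Ioi 0)) := by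
  have hi1 : Integrable ((Ioi (0 : ℝ)).indicator f) := h1.integrable_indicator measurableSet_Ioi
  have hi2 : MemLp ((Ioi (0 : ℝ)).indicator f) 2 := (memLp_indicator_iff_restrict measurableSet_Ioi).2 h2
  have hm := memLp_fourier hi1 hi2
  have hn := eLpNorm_fourier hi1 hi2
  rw [eLpNorm_indicator_eq_eLpNorm_restrict measurableSet_Ioi] at hn
  set F := FourierTransform.fourier ((Ioi (0 : ℝ)).indicator f) with hF
  set a : ℝ := -(2 * Real.pi)⁻¹ with ha
  have ha0 : a ≠ 0 := by rw [ha]; have := Real.pi_pos; exact neg_ne_zero.2 (by positivity)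
  have hainv : |a⁻¹| = 2 * Real.pi := by
    rw [ha, inv_neg, inv_inv, abs_neg, abs_of_pos (by positivity)]
  have hfun : (fun ξ : ℝ => halfLineTransform f (ξ : ℂ)) = F ∘ (fun ξ => a * ξ) := by
    ext ξ; exact halfLineTransform_ofReal f ξ
  have hmap : Measure.map (fun ξ : ℝ => a * ξ) volume = ENNReal.ofReal (2 * Real.pi) • volume := by
    rw [← hainv]; exact Real.map_volume_mul_left ha0
  have hae : AEMeasurable (fun ξ : ℝ => a * ξ) volume := by fun_prop
  have hm' : MemLp F 2 (Measure.map (fun ξ : ℝ => a * ξ) volume) := by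
    rw [hmap]; exact hm.smul_measure ENNReal.ofReal_ne_top
  rw [hfun]
  refine ⟨hm'.comp_of_map hae, ?_⟩
  rw [← eLpNorm_map_measure hm'.1 hae, hmap, eLpNorm_smul_measure_of_ne_top (by simp), hn]
  congr 1
  rw [Real.sqrt_eq_rpow, ← ENNReal.ofReal_rpow_of_nonneg (by positivity) (by norm_num)]
  norm_num

theorem integrableOn_pow_mul_exp_neg {σ : ℝ} (hσ : 0 < σ) (k : ℕ) :
    IntegrableOn (fun t : ℝ => t ^ k * Real.exp (-(σ * t))) (Ioi 0) := by
  have h := integrableOn_rpow_mul_exp_neg_mul_rpow (p := 1) (s := k) (b := σ)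
    (by have : (0 : ℝ) ≤ k := by positivity
        linarith) one_pos hσ
  refine h.congr_fun (fun t ht => ?_) measurableSet_Ioi
  simp

theorem norm_exp_neg_mul_ofReal (p : ℂ) (t : ℝ) :
    ‖Complex.exp (-(p * t))‖ = Real.exp (-(p.re * t)) := by
  simp [Complex.norm_exp]

theorem integrableOn_pow_mul_cexp_neg {p : ℂ} (hp : 0 < p.re) (k : ℕ) :
    IntegrableOn (fun t : ℝ => (t : ℂ) ^ k * Complex.exp (-(p * t))) (Ioi 0) := by
  refine (integrableOn_pow_mul_exp_neg hp k).mono' ?_ ?_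
  · exact (by fun_prop : Continuous fun t : ℝ => (t : ℂ) ^ k * Complex.exp (-(p * t))).aestronglyMeasurable
  · filter_upwards [ae_restrict_mem measurableSet_Ioi] with t ht
    rw [norm_mul, norm_exp_neg_mul_ofReal, norm_pow, Complex.norm_real, Real.norm_of_nonneg (le_of_lt ht)]

theorem integral_pow_mul_cexp_neg {p : ℂ} (hp : 0 < p.re) (k : ℕ) :
    ∫ t in Ioi (0 : ℝ), (t : ℂ) ^ k * Complex.exp (-(p * t)) = k.factorial / p ^ (k + 1) := by
  have hp0 : p ≠ 0 := by rintro rfl; simp at hp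
  have hexp (t : ℝ) : HasDerivAt (fun t : ℝ => Complex.exp (-(p * t)))
      (-(p * Complex.exp (-(p * t)))) t := by
    have h1 : HasDerivAt (fun t : ℝ => -(p * (t : ℂ))) (-(p * 1)) t :=
      ((Complex.ofRealCLM.hasDerivAt (x := t)).const_mul p).neg
    convert! h1.cexp using 1; ring
  induction k with
  | zero =>
    have hi := integrableOn_pow_mul_cexp_neg hp 0
    simp only [pow_zero, one_mul] at hi
    have hi' : IntegrableOn (fun t : ℝ => -(p * Complex.exp (-(p * t)))) (Ioi 0) :=
      (hi.const_mul p).neg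
    have ht := tendsto_zero_of_hasDerivAt_of_integrableOn_Ioi (fun t _ => hexp t) hi' hi
    have h := integral_Ioi_of_hasDerivAt_of_tendsto' (a := (0 : ℝ)) (fun t _ => hexp t) hi' ht
    rw [integral_neg, integral_const_mul] at h
    simp only [pow_zero, one_mul, Nat.factorial_zero, Nat.cast_one, zero_add, pow_one]
    simp at h
    field_simp
    exact h
  | succ k ih =>
    have hi := integrableOn_pow_mul_cexp_neg hp (k + 1)
    have hi0 := integrableOn_pow_mul_cexp_neg hp k
    have hd (t : ℝ) : HasDerivAt (fun t : ℝ => (t : ℂ) ^ (k + 1) * Complex.exp (-(p * t)))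
        (((k : ℂ) + 1) * ((t : ℂ) ^ k * Complex.exp (-(p * t)))
          - p * ((t : ℂ) ^ (k + 1) * Complex.exp (-(p * t)))) t := by
      have h1 : HasDerivAt (fun t : ℝ => (t : ℂ) ^ (k + 1)) (((k : ℂ) + 1) * (t : ℂ) ^ k) t := by
        have := (Complex.ofRealCLM.hasDerivAt (x := t)).pow (k + 1)
        convert! this using 1; simp
      convert! h1.mul (hexp t) using 1; ring
    have hi' := (hi0.const_mul ((k : ℂ) + 1)).sub (hi.const_mul p)
    have ht := tendsto_zero_of_hasDerivAt_of_integrableOn_Ioi (fun t _ => hd t) hi' hi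
    have h := integral_Ioi_of_hasDerivAt_of_tendsto' (a := (0 : ℝ)) (fun t _ => hd t) hi' ht
    rw [integral_sub (hi0.const_mul _) (hi.const_mul _), integral_const_mul, integral_const_mul,
      ih] at h
    simp at h
    rw [Nat.factorial_succ, pow_succ p (k + 1)]
    push_cast
    have h2 : p * ∫ t in Ioi (0 : ℝ), (t : ℂ) ^ (k + 1) * Complex.exp (-(p * t))
        = ((k : ℂ) + 1) * ((k.factorial : ℂ) / p ^ (k + 1)) := by linear_combination -h
    field_simp at h2 ⊢
    linear_combination h2

/-- The Laguerre functions `L_n(t) e^{-t/2}`. -/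
def laguerreFun (n : ℕ) (t : ℝ) : ℂ := ((laguerre n t * Real.exp (-t / 2) : ℝ) : ℂ)

theorem laguerreFun_eq_sum (n : ℕ) (t : ℝ) :
    laguerreFun n t = ∑ k ∈ Finset.range (n + 1),
      ((n.choose k : ℂ) * (-1) ^ k / (k.factorial : ℂ)) *
        ((t : ℂ) ^ k * Complex.exp (-((1 / 2 : ℂ) * t))) := by
  rw [laguerreFun, laguerre, Finset.sum_mul]
  push_cast
  refine Finset.sum_congr rfl fun k _ => ?_
  rw [neg_pow (t : ℂ), show -(t : ℂ) / 2 = -((1 / 2 : ℂ) * t) by ring]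
  ring

theorem continuous_laguerreFun (n : ℕ) : Continuous (laguerreFun n) := by
  have : laguerreFun n = fun t => _ := funext (laguerreFun_eq_sum n)
  rw [this]
  fun_prop

theorem conj_laguerreFun (n : ℕ) (t : ℝ) :
    (starRingEnd ℂ) (laguerreFun n t) = laguerreFun n t := Complex.conj_ofReal _

theorem halfLineTransform_laguerreFun (n : ℕ) {ρ : ℂ} (hρ : 0 ≤ ρ.im) :
    halfLineTransform (laguerreFun n) ρ = (zParam ρ + 1) * ((-1) ^ n * zParam ρ ^ n) := by
  set p : ℂ := 1 / 2 - Complex.I * ρ with hp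
  have hpre : 0 < p.re := by
    simp [hp]; linarith
  have hp0 : p ≠ 0 := by intro h; simp [h] at hpre
  have hcalc : ∀ t : ℝ, laguerreFun n t * Complex.exp (Complex.I * ρ * t)
      = ∑ k ∈ Finset.range (n + 1), ((n.choose k : ℂ) * (-1) ^ k / (k.factorial : ℂ)) *
        ((t : ℂ) ^ k * Complex.exp (-(p * t))) := by
    intro t
    rw [laguerreFun_eq_sum, Finset.sum_mul]
    refine Finset.sum_congr rfl fun k _ => ?_
    rw [show -(p * t) = -((1 / 2 : ℂ) * t) + Complex.I * ρ * t by rw [hp]; ring, Complex.exp_add]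
    ring
  rw [halfLineTransform]
  simp_rw [hcalc]
  rw [integral_finsetSum _ (fun k _ => (integrableOn_pow_mul_cexp_neg hpre k).const_mul _)]
  simp_rw [integral_const_mul, integral_pow_mul_cexp_neg hpre]
  have hz1 : zParam ρ + 1 = 1 / p := by
    rw [zParam, ← hp]; field_simp; rw [hp]; ring
  have hz2 : -zParam ρ = -(1 / p) + 1 := by linear_combination -hz1
  rw [← mul_pow, neg_one_mul, hz1, hz2, add_pow, Finset.mul_sum]
  refine Finset.sum_congr rfl fun k _ => ?_
  have hk : (k.factorial : ℂ) ≠ 0 := by exact_mod_cast k.factorial_ne_zero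
  rw [neg_pow (1 / p), one_pow, div_pow, one_pow]
  field_simp
  ring

theorem sum_neg_one_pow_choose_mul_choose_add (n j : ℕ) :
    ∑ k ∈ Finset.range (n + 1), (-1 : ℤ) ^ (n - k) * n.choose k * ((j + k).choose j : ℤ)
      = (j.choose n : ℤ) := by
  have h := fwdDiff_iter_eq_sum_shift (1 : ℕ) (fun x : ℕ => (x.choose j : ℤ)) n j
  simp only [smul_eq_mul, mul_one] at h
  rw [← h]
  rcases le_or_gt n j with hnj | hnj
  · obtain ⟨i, rfl⟩ := Nat.exists_eq_add_of_le hnj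
    rw [fwdDiff_iter_choose]
    change ((n + i).choose i : ℤ) = _
    exact_mod_cast (Nat.choose_symm_add (a := n) (b := i)).symm
  · obtain ⟨i, rfl⟩ := Nat.exists_eq_add_of_lt hnj
    rw [show j + i + 1 = (i + 1) + j by ring, Function.iterate_add_apply]
    have := fwdDiff_iter_choose 0 j
    rw [add_zero] at this
    rw [this, Nat.choose_eq_zero_of_lt (by omega)]
    simp_rw [Nat.choose_zero_right, Nat.cast_one, Function.iterate_succ_apply, fwdDiff_const,
      fwdDiff_iter_eq_sum_shift, smul_zero, Finset.sum_const_zero, Nat.cast_zero]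

theorem sum_neg_one_pow_choose_mul_choose (m n : ℕ) :
    ∑ j ∈ Finset.range (m + 1), (-1 : ℤ) ^ (m - j) * m.choose j * (j.choose n : ℤ)
      = if m = n then 1 else 0 := by
  have h := fwdDiff_iter_eq_sum_shift (1 : ℕ) (fun x : ℕ => (x.choose n : ℤ)) m 0
  simp only [smul_eq_mul, mul_one, zero_add] at h
  rw [← h, fwdDiff_iter_choose_zero]

theorem integral_laguerreFun_mul_laguerreFun (m n : ℕ) :
    ∫ t in Ioi (0 : ℝ), laguerreFun m t * laguerreFun n t = if m = n then 1 else 0 := by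
  have h1 : (0 : ℝ) < (1 : ℂ).re := by simp
  have hcalc : ∀ t : ℝ, laguerreFun m t * laguerreFun n t
      = ∑ j ∈ Finset.range (m + 1), ∑ k ∈ Finset.range (n + 1),
        ((m.choose j : ℂ) * (-1) ^ j / (j.factorial : ℂ)) *
        ((n.choose k : ℂ) * (-1) ^ k / (k.factorial : ℂ)) *
        ((t : ℂ) ^ (j + k) * Complex.exp (-(1 * t))) := by
    intro t
    rw [laguerreFun_eq_sum, laguerreFun_eq_sum, Finset.sum_mul_sum]
    refine Finset.sum_congr rfl fun j _ => Finset.sum_congr rfl fun k _ => ?_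
    rw [show -((1 : ℂ) * t) = -((1 / 2 : ℂ) * t) + -((1 / 2 : ℂ) * t) by ring, Complex.exp_add]
    ring
  simp_rw [hcalc]
  rw [integral_finsetSum _ (fun j _ => integrable_finsetSum _ fun k _ =>
    (integrableOn_pow_mul_cexp_neg h1 _).const_mul _)]
  have hin : ∀ j, ∫ t in Ioi (0 : ℝ), ∑ k ∈ Finset.range (n + 1),
        ((m.choose j : ℂ) * (-1) ^ j / (j.factorial : ℂ)) *
        ((n.choose k : ℂ) * (-1) ^ k / (k.factorial : ℂ)) *
        ((t : ℂ) ^ (j + k) * Complex.exp (-(1 * t)))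
      = (m.choose j : ℂ) * (-1) ^ j * ((-1) ^ n * (j.choose n : ℂ)) := by
    intro j
    rw [integral_finsetSum _ (fun k _ => (integrableOn_pow_mul_cexp_neg h1 _).const_mul _)]
    simp_rw [integral_const_mul, integral_pow_mul_cexp_neg h1]
    have hs := congrArg (Int.cast : ℤ → ℂ) (sum_neg_one_pow_choose_mul_choose_add n j)
    push_cast at hs
    rw [← hs, Finset.mul_sum, Finset.mul_sum]
    refine Finset.sum_congr rfl fun k hk => ?_
    have hkn : k ≤ n := by simpa [Nat.lt_succ_iff] using hk
    have hf : ((j + k).factorial : ℂ) = (j + k).choose j * j.factorial * k.factorial := by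
      have := Nat.add_choose_mul_factorial_mul_factorial j k
      rw [Nat.choose_symm_add] at *
      exact_mod_cast this.symm
    have hj0 : (j.factorial : ℂ) ≠ 0 := by exact_mod_cast j.factorial_ne_zero
    have hk0 : (k.factorial : ℂ) ≠ 0 := by exact_mod_cast k.factorial_ne_zero
    have hsign : (-1 : ℂ) ^ n * (-1) ^ (n - k) = (-1) ^ k := by
      obtain ⟨i, rfl⟩ := Nat.exists_eq_add_of_le hkn
      rw [Nat.add_sub_cancel_left, pow_add, mul_assoc, ← mul_pow]; simp
    rw [hf, one_pow, ← hsign]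
    field_simp
  simp_rw [hin]
  have hs := congrArg (Int.cast : ℤ → ℂ) (sum_neg_one_pow_choose_mul_choose m n)
  push_cast at hs
  have : ∑ j ∈ Finset.range (m + 1), (m.choose j : ℂ) * (-1) ^ j * ((-1) ^ n * (j.choose n : ℂ))
      = (-1) ^ m * (-1) ^ n * ∑ j ∈ Finset.range (m + 1),
        (-1 : ℂ) ^ (m - j) * m.choose j * (j.choose n : ℂ) := by
    rw [Finset.mul_sum]
    refine Finset.sum_congr rfl fun j hj => ?_
    have hjm : j ≤ m := by simpa [Nat.lt_succ_iff] using hj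
    have hsign : (-1 : ℂ) ^ m * (-1) ^ (m - j) = (-1) ^ j := by
      obtain ⟨i, rfl⟩ := Nat.exists_eq_add_of_le hjm
      rw [Nat.add_sub_cancel_left, pow_add, mul_assoc, ← mul_pow]; simp
    rw [← hsign]; ring
  rw [this, hs]
  split_ifs with h
  · subst h; rw [← mul_pow]; simp
  · simp

theorem memLp_two_pow_mul_cexp_neg {p : ℂ} (hp : 0 < p.re) (k : ℕ) :
    MemLp (fun t : ℝ => (t : ℂ) ^ k * Complex.exp (-(p * t))) 2 (volume.restrict (Ioi 0)) := by
  have hc : Continuous fun t : ℝ => (t : ℂ) ^ k * Complex.exp (-(p * t)) := by fun_prop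
  rw [memLp_two_iff_integrable_sq_norm hc.aestronglyMeasurable]
  have h2 : 0 < 2 * p.re := by linarith
  refine (integrableOn_pow_mul_exp_neg h2 (k * 2)).congr_fun (fun t ht => ?_) measurableSet_Ioi
  rw [mem_Ioi] at ht
  simp only [norm_mul, norm_exp_neg_mul_ofReal, norm_pow, Complex.norm_real, Real.norm_of_nonneg ht.le]
  rw [mul_pow, ← pow_mul, ← Real.exp_nat_mul]
  congr 2; push_cast; ring

theorem integrable_mul_pow_mul_cexp_neg {f : ℝ → ℂ} (hf : MemLp f 2 (volume.restrict (Ioi 0)))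
    {p : ℂ} (hp : 0 < p.re) (k : ℕ) :
    IntegrableOn (fun t : ℝ => f t * ((t : ℂ) ^ k * Complex.exp (-(p * t)))) (Ioi 0) :=
  hf.integrable_mul (memLp_two_pow_mul_cexp_neg hp k)

theorem moments_eq_zero_shift {f : ℝ → ℂ} (hf : MemLp f 2 (volume.restrict (Ioi 0)))
    {p c : ℂ} (hc : ‖c‖ < p.re)
    (h : ∀ k : ℕ, ∫ t in Ioi (0 : ℝ), f t * ((t : ℂ) ^ k * Complex.exp (-(p * t))) = 0) (k : ℕ) :
    ∫ t in Ioi (0 : ℝ), f t * ((t : ℂ) ^ k * Complex.exp (-((p - c) * t))) = 0 := by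
  have hp' : 0 < ((p.re - ‖c‖ : ℝ) : ℂ).re := by simpa using hc
  have hkey := hasSum_integral_of_dominated_convergence (μ := volume.restrict (Ioi (0 : ℝ)))
    (F := fun (j : ℕ) (t : ℝ) => (c ^ j / (j.factorial : ℂ)) *
      (f t * ((t : ℂ) ^ (k + j) * Complex.exp (-(p * t)))))
    (f := fun t : ℝ => f t * ((t : ℂ) ^ k * Complex.exp (-((p - c) * t))))
    (fun j t => ‖f t‖ * (t ^ k * Real.exp (-(p.re * t))) * ((‖c‖ * t) ^ j / (j.factorial : ℝ)))
    ?_ ?_ ?_ ?_ ?_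
  · have : (fun j : ℕ => ∫ t in Ioi (0 : ℝ), (c ^ j / (j.factorial : ℂ)) *
      (f t * ((t : ℂ) ^ (k + j) * Complex.exp (-(p * t))))) = fun _ => 0 := by
      ext j
      rw [integral_const_mul, h, mul_zero]
    rw [this] at hkey
    exact hkey.unique hasSum_zero
  · intro j
    refine AEStronglyMeasurable.const_mul (hf.1.mul ?_) _
    exact (by fun_prop : Continuous fun t : ℝ => (t : ℂ) ^ (k + j) * Complex.exp (-(p * t))).aestronglyMeasurable
  · intro j
    filter_upwards [ae_restrict_mem measurableSet_Ioi] with t ht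
    rw [mem_Ioi] at ht
    apply le_of_eq
    simp only [norm_mul, norm_div, norm_exp_neg_mul_ofReal, norm_pow, Complex.norm_real,
      Real.norm_of_nonneg ht.le, Complex.norm_natCast]
    rw [mul_pow, pow_add]; ring
  · refine Eventually.of_forall fun t => ?_
    exact (Real.summable_pow_div_factorial _).mul_left _
  · have hi := (integrable_mul_pow_mul_cexp_neg hf hp' k).norm
    refine hi.congr ?_
    filter_upwards [ae_restrict_mem measurableSet_Ioi] with t ht
    rw [mem_Ioi] at ht
    have he : ∑' j : ℕ, (‖c‖ * t) ^ j / (j.factorial : ℝ) = Real.exp (‖c‖ * t) := by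
      rw [Real.exp_eq_exp_ℝ, NormedSpace.exp_eq_tsum_div]
    rw [tsum_mul_left, he]
    simp only [norm_mul, norm_exp_neg_mul_ofReal, norm_pow, Complex.norm_real,
      Real.norm_of_nonneg ht.le, Complex.ofReal_re]
    rw [mul_assoc, mul_assoc, ← Real.exp_add]
    congr 3; ring
  · refine Eventually.of_forall fun t => ?_
    have he : HasSum (fun j : ℕ => (c * t) ^ j / (j.factorial : ℂ)) (Complex.exp (c * t)) := by
      rw [Complex.exp_eq_exp_ℂ]
      exact NormedSpace.expSeries_div_hasSum_exp (c * t : ℂ)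
    have he' := he.mul_left (f t * ((t : ℂ) ^ k * Complex.exp (-(p * t))))
    convert! he' using 1
    · ext j
      rw [mul_pow, pow_add]; ring
    · rw [show -((p - c) * t) = -(p * t) + c * t by ring, Complex.exp_add]; ring

theorem ae_eq_zero_of_halfLineTransform_eq_zero {f : ℝ → ℂ}
    (hf : MemLp f 2 (volume.restrict (Ioi 0)))
    (h : ∀ ξ : ℝ, halfLineTransform f ((ξ : ℂ) + Complex.I / 2) = 0) :
    f =ᵐ[volume.restrict (Ioi 0)] 0 := by
  have hhalf : 0 < (1 / 2 : ℂ).re := by norm_num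
  set F : ℝ → ℂ := fun t => f t * ((t : ℂ) ^ 0 * Complex.exp (-((1 / 2 : ℂ) * t))) with hF
  have h1 : IntegrableOn F (Ioi 0) := integrable_mul_pow_mul_cexp_neg hf hhalf 0
  have h2 : MemLp F 2 (volume.restrict (Ioi 0)) := by
    refine hf.mono h1.1 ?_
    filter_upwards [ae_restrict_mem measurableSet_Ioi] with t ht
    rw [mem_Ioi] at ht
    rw [hF]
    simp only [norm_mul, pow_zero, one_mul, norm_exp_neg_mul_ofReal]
    refine mul_le_of_le_one_right (norm_nonneg _) (Real.exp_le_one_iff.2 ?_)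
    norm_num; linarith
  have hz : (fun ξ : ℝ => halfLineTransform F (ξ : ℂ)) = fun _ => 0 := by
    ext ξ
    rw [← h ξ, halfLineTransform, halfLineTransform]
    congr 1; ext t
    rw [hF]
    simp only [pow_zero, one_mul]
    rw [mul_assoc, ← Complex.exp_add]
    congr 2
    linear_combination (-(t : ℂ) / 2) * Complex.I_sq
  have hn := (memLp_eLpNorm_halfLineTransform h1 h2).2
  rw [hz] at hn
  rw [show eLpNorm (fun _ : ℝ => (0 : ℂ)) 2 volume = 0 from eLpNorm_zero] at hn
  have hpos : ENNReal.ofReal (Real.sqrt (2 * Real.pi)) ≠ 0 := by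
    rw [Ne, ENNReal.ofReal_eq_zero, not_le]; have := Real.pi_pos; positivity
  have h0 : eLpNorm F 2 (volume.restrict (Ioi 0)) = 0 := by
    rcases mul_eq_zero.1 hn.symm with h | h
    · exact absurd h hpos
    · exact h
  rw [eLpNorm_eq_zero_iff h1.1 (by norm_num)] at h0
  filter_upwards [h0] with t ht
  simpa [hF, Complex.exp_ne_zero] using ht

theorem ae_eq_zero_of_moments_eq_zero {f : ℝ → ℂ} (hf : MemLp f 2 (volume.restrict (Ioi 0)))
    (h : ∀ k : ℕ, ∫ t in Ioi (0 : ℝ), f t * ((t : ℂ) ^ k * Complex.exp (-((1 / 2 : ℂ) * t))) = 0) :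
    f =ᵐ[volume.restrict (Ioi 0)] 0 := by
  refine ae_eq_zero_of_halfLineTransform_eq_zero hf fun ξ => ?_
  obtain ⟨N, hN⟩ := exists_nat_gt (2 * |ξ|)
  have hN0 : (0 : ℝ) < N := lt_of_le_of_lt (by positivity) hN
  set c : ℂ := Complex.I * (ξ / N : ℝ) with hc
  have hcn : ‖c‖ < 1 / 2 := by
    rw [hc, norm_mul, Complex.norm_I, one_mul, Complex.norm_real, Real.norm_eq_abs, abs_div,
      abs_of_pos hN0, div_lt_iff₀ hN0]
    linarith
  have hcre : c.re = 0 := by simp [hc]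
  have hm : ∀ m : ℕ, ∀ k : ℕ,
      ∫ t in Ioi (0 : ℝ), f t * ((t : ℂ) ^ k * Complex.exp (-((1 / 2 - m * c) * t))) = 0 := by
    intro m
    induction m with
    | zero => simpa using h
    | succ m ih =>
      intro k
      have := moments_eq_zero_shift hf (c := c) (p := 1 / 2 - m * c) (by simp [hcre]; linarith) ih k
      rw [← this]
      congr 1; ext t; push_cast; ring_nf
  have hfin := hm N 0
  rw [halfLineTransform, ← hfin]
  congr 1; ext t
  rw [pow_zero, one_mul]
  congr 2
  have hNc : (N : ℂ) ≠ 0 := by exact_mod_cast hN0.ne'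
  have : (N : ℂ) * c = Complex.I * ξ := by
    rw [hc]; push_cast; field_simp
  rw [this]
  linear_combination ((t : ℂ) / 2) * Complex.I_sq

theorem moments_eq_zero_of_laguerre {f : ℝ → ℂ} (hf : MemLp f 2 (volume.restrict (Ioi 0)))
    (h : ∀ n : ℕ, ∫ t in Ioi (0 : ℝ), f t * laguerreFun n t = 0) (k : ℕ) :
    ∫ t in Ioi (0 : ℝ), f t * ((t : ℂ) ^ k * Complex.exp (-((1 / 2 : ℂ) * t))) = 0 := by
  have hhalf : 0 < (1 / 2 : ℂ).re := by norm_num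
  induction k using Nat.strong_induction_on with
  | _ n ih =>
    have hn := h n
    have hcalc (t : ℝ) : f t * laguerreFun n t = ∑ k ∈ Finset.range (n + 1),
        ((n.choose k : ℂ) * (-1) ^ k / (k.factorial : ℂ)) *
          (f t * ((t : ℂ) ^ k * Complex.exp (-((1 / 2 : ℂ) * t)))) := by
      rw [laguerreFun_eq_sum, Finset.mul_sum]
      exact Finset.sum_congr rfl fun k _ => mul_left_comm _ _ _
    simp_rw [hcalc] at hn
    rw [integral_finsetSum _ (fun k _ => (integrable_mul_pow_mul_cexp_neg hf hhalf k).const_mul _)] at hn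
    simp_rw [integral_const_mul] at hn
    rw [Finset.sum_range_succ, Finset.sum_eq_zero, zero_add] at hn
    · rcases mul_eq_zero.1 hn with h0 | h0
      · have hk0 : (n.factorial : ℂ) ≠ 0 := by exact_mod_cast n.factorial_ne_zero
        simp [hk0] at h0
      · exact h0
    · intro j hj
      rw [ih j (Finset.mem_range.1 hj), mul_zero]

theorem memLp_laguerreFun (n : ℕ) : MemLp (laguerreFun n) 2 (volume.restrict (Ioi 0)) := by
  have hhalf : 0 < (1 / 2 : ℂ).re := by norm_num
  have : laguerreFun n = fun t => _ := funext (laguerreFun_eq_sum n)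
  rw [this]
  exact memLp_finsetSum _ fun k _ => (memLp_two_pow_mul_cexp_neg hhalf k).const_mul _

/-- The space `L₂(0, ∞)`. -/
abbrev HalfLineL2 : Type := Lp ℂ 2 (volume.restrict (Ioi (0 : ℝ)))

theorem inner_laguerreFun {f : ℝ → ℂ} (hf : MemLp f 2 (volume.restrict (Ioi 0))) (n : ℕ) :
    inner ℂ ((memLp_laguerreFun n).toLp _ : HalfLineL2) (hf.toLp f)
      = ∫ t in Ioi (0 : ℝ), f t * laguerreFun n t := by
  rw [L2.inner_def]
  apply integral_congr_ae
  filter_upwards [(memLp_laguerreFun n).coeFn_toLp, hf.coeFn_toLp] with t h1 h2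
  rw [h1, h2, RCLike.inner_apply, conj_laguerreFun]

theorem orthonormal_laguerreFun :
    Orthonormal ℂ (fun n => ((memLp_laguerreFun n).toLp _ : HalfLineL2)) := by
  rw [orthonormal_iff_ite]
  intro m n
  rw [inner_laguerreFun, integral_laguerreFun_mul_laguerreFun]
  simp only [eq_comm]

/-- The Laguerre functions as a Hilbert basis of `L₂(0, ∞)`. -/
def laguerreBasis : HilbertBasis ℕ ℂ HalfLineL2 :=
  HilbertBasis.mkOfOrthogonalEqBot orthonormal_laguerreFun (by
    rw [Submodule.eq_bot_iff]
    intro f hf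
    rw [Submodule.mem_orthogonal] at hf
    have hfm := Lp.memLp f
    have hf' : hfm.toLp _ = f := Lp.toLp_coeFn f hfm
    have h0 : ∀ n : ℕ, ∫ t in Ioi (0 : ℝ), f t * laguerreFun n t = 0 := by
      intro n
      rw [← inner_laguerreFun hfm n, hf']
      exact hf _ (Submodule.subset_span ⟨n, rfl⟩)
    rw [Lp.eq_zero_iff_ae_eq_zero]
    exact ae_eq_zero_of_moments_eq_zero hfm (moments_eq_zero_of_laguerre hfm h0))

theorem laguerreBasis_apply (n : ℕ) :
    laguerreBasis n = (memLp_laguerreFun n).toLp _ := by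
  simp [laguerreBasis]

theorem hasSum_norm_sq_inner_laguerreBasis (f : HalfLineL2) :
    HasSum (fun n => ‖inner ℂ (laguerreBasis n) f‖ ^ 2) (‖f‖ ^ 2) := by
  have h := laguerreBasis.hasSum_inner_mul_inner f f
  have h2 := Complex.reCLM.hasSum h
  rw [inner_self_eq_norm_sq_to_K] at h2
  convert! h2 using 1
  · ext n
    rw [← inner_conj_symm f, ← Complex.normSq_eq_conj_mul_self]
    rw [Complex.normSq_eq_norm_sq]
    exact (Complex.ofReal_re _).symm
  · simp [← Complex.ofReal_pow]

theorem norm_sub_sum_laguerreBasis (f : HalfLineL2) (N : ℕ) :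
    ‖f - ∑ n ∈ Finset.range (N + 1), inner ℂ (laguerreBasis n) f • laguerreBasis n‖
      = tailNorm (fun n => inner ℂ (laguerreBasis n) f) N := by
  set g := f - ∑ n ∈ Finset.range (N + 1), inner ℂ (laguerreBasis n) f • laguerreBasis n with hg
  have hgi : ∀ m, inner ℂ (laguerreBasis m) g
      = if m < N + 1 then 0 else inner ℂ (laguerreBasis m) f := by
    intro m
    have ho := orthonormal_iff_ite.1 laguerreBasis.orthonormal
    rw [hg, inner_sub_right, inner_sum]
    simp_rw [inner_smul_right, ho]
    simp only [mul_ite, mul_one, mul_zero, Finset.sum_ite_eq, Finset.mem_range]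
    split_ifs <;> simp
  have hs := hasSum_norm_sq_inner_laguerreBasis g
  have h1 := hs.summable.sum_add_tsum_nat_add (N + 1)
  rw [Finset.sum_eq_zero, zero_add, hs.tsum_eq] at h1
  · rw [tailNorm, ← Real.sqrt_sq (norm_nonneg g), ← h1]
    congr 1
    refine tsum_congr fun n => ?_
    rw [hgi, if_neg (by omega), add_comm]
  · intro m hm
    rw [hgi, if_pos (Finset.mem_range.1 hm)]
    simp

/-- The remainder of the Fourier-Laguerre expansion of `f`. -/
def laguerreRemainder (f : ℝ → ℂ) (c : ℕ → ℂ) (N : ℕ) (t : ℝ) : ℂ :=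
  f t - ∑ n ∈ Finset.range (N + 1), c n * laguerreFun n t

theorem memLp_laguerreRemainder {f : ℝ → ℂ} (hf : MemLp f 2 (volume.restrict (Ioi 0)))
    (c : ℕ → ℂ) (N : ℕ) : MemLp (laguerreRemainder f c N) 2 (volume.restrict (Ioi 0)) :=
  hf.sub (memLp_finsetSum _ fun n _ => (memLp_laguerreFun n).const_mul _)

theorem summable_norm_sq_laguerre_coeff {f : ℝ → ℂ} (hf : MemLp f 2 (volume.restrict (Ioi 0)))
    {c : ℕ → ℂ} (hc : ∀ n, c n = ∫ t in Ioi (0 : ℝ), f t * laguerreFun n t) :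
    Summable fun n => ‖c n‖ ^ 2 := by
  have := (hasSum_norm_sq_inner_laguerreBasis (hf.toLp f)).summable
  simp_rw [laguerreBasis_apply, inner_laguerreFun hf, ← hc] at this
  exact this

theorem eLpNorm_laguerreRemainder {f : ℝ → ℂ} (hf : MemLp f 2 (volume.restrict (Ioi 0)))
    {c : ℕ → ℂ} (hc : ∀ n, c n = ∫ t in Ioi (0 : ℝ), f t * laguerreFun n t) (N : ℕ) :
    eLpNorm (laguerreRemainder f c N) 2 (volume.restrict (Ioi 0))
      = ENNReal.ofReal (tailNorm c N) := by
  have h := norm_sub_sum_laguerreBasis (hf.toLp f) N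
  simp_rw [laguerreBasis_apply, inner_laguerreFun hf, ← hc] at h
  rw [← h, ofReal_norm, Lp.enorm_def]
  apply eLpNorm_congr_ae
  have hsum : (((∑ n ∈ Finset.range (N + 1), c n • (memLp_laguerreFun n).toLp _ : HalfLineL2)) : ℝ → ℂ)
      =ᵐ[volume.restrict (Ioi 0)] fun t => ∑ n ∈ Finset.range (N + 1), c n * laguerreFun n t := by
    refine (Lp.coeFn_finsetSum _ _).trans ?_
    have hall : ∀ᵐ t ∂(volume.restrict (Ioi (0 : ℝ))), ∀ n,
        ((c n • (memLp_laguerreFun n).toLp _ : HalfLineL2) : ℝ → ℂ) t = c n * laguerreFun n t := by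
      rw [ae_all_iff]
      intro n
      filter_upwards [Lp.coeFn_smul (c n) ((memLp_laguerreFun n).toLp _ : HalfLineL2),
        (memLp_laguerreFun n).coeFn_toLp] with t h1 h2
      rw [h1, Pi.smul_apply, h2, smul_eq_mul]
    filter_upwards [hall] with t ht
    simp [Finset.sum_apply, ht]
  filter_upwards [Lp.coeFn_sub (hf.toLp f) (∑ n ∈ Finset.range (N + 1),
    c n • (memLp_laguerreFun n).toLp _ : HalfLineL2), hsum, hf.coeFn_toLp] with t h1 h2 h3
  rw [h1, Pi.sub_apply, h2, h3, laguerreRemainder]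

theorem ClassL11.integrable {E : Type*} [NormedAddCommGroup E] {f : ℝ → E} (hf : ClassL11 f) :
    Integrable f := by
  refine hf.2.mono hf.1 (Eventually.of_forall fun x => ?_)
  rw [Real.norm_of_nonneg (by positivity)]
  nlinarith [norm_nonneg (f x), abs_nonneg x, mul_nonneg (abs_nonneg x) (norm_nonneg (f x))]

theorem PiecewiseC1.exists_countable {q : ℝ → ℝ} (hq : PiecewiseC1 q) :
    ∃ S : Set ℝ, S.Countable ∧ ∀ x, x ∉ S → ContDiffAt ℝ 1 q x := by
  obtain ⟨-, S, hS, hd⟩ := hq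
  refine ⟨S, ?_, hd⟩
  have : S = ⋃ n : ℕ, S ∩ Icc (-(n : ℝ)) n := by
    ext x
    simp only [mem_iUnion, mem_inter_iff, mem_Icc]
    refine ⟨fun hx => ?_, fun ⟨_, h, _⟩ => h⟩
    obtain ⟨n, hn⟩ := exists_nat_ge |x|
    exact ⟨n, hx, abs_le.1 hn⟩
  rw [this]
  exact countable_iUnion fun n => (hS n).countable

theorem integral_deriv_eq_sub_of_piecewiseC1 {q : ℝ → ℝ} (hq : PiecewiseC1 q)
    (hq' : Integrable (deriv q)) (a b : ℝ) : ∫ t in a..b, deriv q t = q b - q a := by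
  obtain ⟨S, hS, hd⟩ := hq.exists_countable
  exact integral_eq_of_hasDerivAt_off_countable q (deriv q) hS hq.1.continuousOn
    (fun x hx => ((hd x hx.2).differentiableAt (by norm_num)).hasDerivAt) hq'.intervalIntegrable

/-- The tail `∫_r^∞ |q'|`. -/
def derivTail (q : ℝ → ℝ) (r : ℝ) : ℝ := ∫ t in Ioi r, |deriv q t|

theorem tendsto_atTop_zero_of_piecewiseC1 {q : ℝ → ℝ} (hq : PiecewiseC1 q)
    (hq2 : Integrable fun x => q x ^ 2) (hq' : Integrable (deriv q)) :
    Tendsto q atTop (𝓝 0) := by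
  have h1 := intervalIntegral_tendsto_integral_Ioi 0 hq'.integrableOn tendsto_id
  simp only [integral_deriv_eq_sub_of_piecewiseC1 hq hq', id] at h1
  have h2 := h1.add_const (q 0)
  simp only [sub_add_cancel] at h2
  set L := (∫ t in Ioi (0 : ℝ), deriv q t) + q 0
  have hL : L ^ 2 = 0 := by
    refine IntegrableAtFilter.eq_zero_of_tendsto (μ := volume) (l := atTop)
      (f := fun x => q x ^ 2) (hq2.integrableAtFilter _) ?_ (h2.pow 2)
    intro s hs
    obtain ⟨b, hb⟩ := mem_atTop_sets.1 hs
    rw [← top_le_iff, ← Real.volume_Ici (a := b)]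
    exact measure_mono hb
  rw [pow_eq_zero_iff two_ne_zero] at hL
  rwa [hL] at h2

theorem abs_le_derivTail {q : ℝ → ℝ} (hq : PiecewiseC1 q)
    (hq2 : Integrable fun x => q x ^ 2) (hq' : Integrable (deriv q)) (r : ℝ) :
    |q r| ≤ derivTail q r := by
  have h1 := intervalIntegral_tendsto_integral_Ioi r hq'.integrableOn tendsto_id
  simp only [integral_deriv_eq_sub_of_piecewiseC1 hq hq', id] at h1
  have h2 := tendsto_nhds_unique h1
    ((tendsto_atTop_zero_of_piecewiseC1 hq hq2 hq').sub_const (q r))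
  rw [zero_sub] at h2
  rw [← abs_neg, ← h2]
  exact abs_integral_le_integral_abs

theorem antitone_derivTail {q : ℝ → ℝ} (hq' : Integrable (deriv q)) : Antitone (derivTail q) :=
  fun _ _ hab => setIntegral_mono_set hq'.abs.integrableOn
    (Eventually.of_forall fun _ => abs_nonneg _) (Ioi_subset_Ioi hab).eventuallyLE

theorem integrableOn_derivTail {q : ℝ → ℝ} (hq' : ClassL11 (deriv q)) (a : ℝ) :
    IntegrableOn (derivTail q) (Ioi a) := by
  have hm : Measurable fun p : ℝ × ℝ => (Iio p.2).indicator (fun _ => |deriv q p.2|) p.1 := by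
    have : (fun p : ℝ × ℝ => (Iio p.2).indicator (fun _ => |deriv q p.2|) p.1)
        = {p : ℝ × ℝ | p.1 < p.2}.indicator fun p => |deriv q p.2| := by
      ext p; simp [indicator]
    rw [this]
    exact (((measurable_deriv q).comp measurable_snd).abs).indicator
      (measurableSet_lt measurable_fst measurable_snd)
  have hval (t : ℝ) : ∫ r in Ioi a, ‖(Iio t).indicator (fun _ => |deriv q t|) r‖
      = max (t - a) 0 * |deriv q t| := by
    have : (fun r => ‖(Iio t).indicator (fun _ => |deriv q t|) r‖)
        = (Iio t).indicator (fun _ => |deriv q t|) := by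
      ext r; rw [norm_indicator_eq_indicator_norm]; simp
    rw [this, setIntegral_indicator measurableSet_Iio, setIntegral_const, Ioi_inter_Iio,
      smul_eq_mul, Real.volume_real_Ioo]
  have hp : Integrable (fun p : ℝ × ℝ => (Iio p.2).indicator (fun _ => |deriv q p.2|) p.1)
      ((volume.restrict (Ioi a)).prod volume) := by
    rw [integrable_prod_iff' hm.aestronglyMeasurable]
    constructor
    · refine Eventually.of_forall fun t => ?_
      change Integrable ((Iio t).indicator fun _ => |deriv q t|) (volume.restrict (Ioi a))
      rw [integrable_indicator_iff measurableSet_Iio, IntegrableOn, Measure.restrict_restrict measurableSet_Iio]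
      refine integrableOn_const (by rw [Iio_inter_Ioi]; simp) (by simp)
    · simp only [hval]
      refine (hq'.2.const_mul (1 + |a|)).mono' ?_ (Eventually.of_forall fun t => ?_)
      · exact (((measurable_id.sub_const a).max measurable_const).mul
          (measurable_deriv q).abs).aestronglyMeasurable
      · rw [Real.norm_eq_abs, abs_mul, abs_abs, Real.norm_eq_abs, ← mul_assoc,
          abs_of_nonneg (le_max_right _ _)]
        refine mul_le_mul_of_nonneg_right (max_le ?_ (by positivity)) (abs_nonneg _)
        nlinarith [le_abs_self t, neg_abs_le a, abs_nonneg t, abs_nonneg a,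
          mul_nonneg (abs_nonneg a) (abs_nonneg t)]
  refine hp.integral_prod_left.congr (Eventually.of_forall fun r => ?_)
  simp only [derivTail]
  rw [← integral_indicator measurableSet_Ioi]
  rfl

/-- `q` is continuous and dominated by a decreasing function integrable near `+∞`. -/
structure IsMajorant (q σ : ℝ → ℝ) : Prop where
  cont : Continuous q
  anti : Antitone σ
  le : ∀ r, |q r| ≤ σ r
  int : ∀ a, IntegrableOn σ (Ioi a)

theorem isMajorant_derivTail {q : ℝ → ℝ} (hq : PiecewiseC1 q)
    (hq2 : ClassL11 fun x => q x ^ 2) (hq' : ClassL11 (deriv q)) :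
    IsMajorant q (derivTail q) :=
  ⟨hq.1, antitone_derivTail hq'.integrable, abs_le_derivTail hq hq2.integrable hq'.integrable,
    integrableOn_derivTail hq'⟩

/-- The weight `exp (2 ∫_x^∞ |q|)`. -/
def expWeight (q : ℝ → ℝ) (x : ℝ) : ℝ := Real.exp (2 * ∫ t in Ioi x, |q t|)

namespace IsMajorant

variable {q σ : ℝ → ℝ}

theorem nonneg (h : IsMajorant q σ) (r : ℝ) : 0 ≤ σ r := (abs_nonneg _).trans (h.le r)

theorem integrableOn (h : IsMajorant q σ) (a : ℝ) : IntegrableOn q (Ioi a) :=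
  (h.int a).mono' h.cont.aestronglyMeasurable (Eventually.of_forall h.le)

theorem hasDerivAt_expWeight (h : IsMajorant q σ) (x : ℝ) :
    HasDerivAt (expWeight q) (-(2 * |q x| * expWeight q x)) x := by
  have hQ : ∀ y, ∫ t in Ioi y, |q t| = (∫ t in Ioi x, |q t|) - ∫ t in x..y, |q t| := by
    intro y
    have := intervalIntegral.integral_Ioi_sub_Ioi' (h.integrableOn x).abs (h.integrableOn y).abs
    linarith
  have hc : Continuous fun t => |q t| := h.cont.abs
  have h1 : HasDerivAt (fun y => ∫ t in Ioi y, |q t|) (-|q x|) x := by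
    rw [funext hQ]
    exact (hc.integral_hasStrictDerivAt x x).hasDerivAt.const_sub _
  have h2 := (h1.const_mul 2).exp
  convert! h2 using 1
  rw [expWeight]; ring

theorem continuous_expWeight (h : IsMajorant q σ) : Continuous (expWeight q) :=
  continuous_iff_continuousAt.2 fun x => (h.hasDerivAt_expWeight x).continuousAt

theorem one_le_expWeight (x : ℝ) : 1 ≤ expWeight q x := by
  rw [expWeight, Real.one_le_exp_iff]
  exact mul_nonneg zero_le_two (integral_nonneg fun _ => abs_nonneg _)

theorem expWeight_pos (x : ℝ) : 0 < expWeight q x := Real.exp_pos _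

theorem antitone_expWeight (h : IsMajorant q σ) : Antitone (expWeight q) := by
  intro a b hab
  rw [expWeight, expWeight, Real.exp_le_exp]
  refine mul_le_mul_of_nonneg_left ?_ zero_le_two
  exact setIntegral_mono_set (h.integrableOn a).abs
    (Eventually.of_forall fun _ => abs_nonneg _) (Ioi_subset_Ioi hab).eventuallyLE

theorem integrableOn_abs_mul_expWeight (h : IsMajorant q σ) (x : ℝ) :
    IntegrableOn (fun t => |q t| * expWeight q t) (Ioi x) := by
  refine ((h.integrableOn x).abs.mul_const (expWeight q x)).mono'
    (h.cont.abs.mul h.continuous_expWeight).aestronglyMeasurable ?_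
  filter_upwards [ae_restrict_mem measurableSet_Ioi] with t ht
  rw [Real.norm_of_nonneg (mul_nonneg (abs_nonneg _) (expWeight_pos t).le)]
  exact mul_le_mul_of_nonneg_left (h.antitone_expWeight (le_of_lt ht)) (abs_nonneg _)

theorem integral_abs_mul_expWeight_le (h : IsMajorant q σ) (x : ℝ) :
    ∫ t in Ioi x, |q t| * expWeight q t ≤ expWeight q x / 2 := by
  have h1 := intervalIntegral_tendsto_integral_Ioi x (h.integrableOn_abs_mul_expWeight x) tendsto_id
  refine le_of_tendsto h1 (Eventually.of_forall fun b => ?_)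
  have hd : ∀ t ∈ uIcc x (id b), HasDerivAt (fun y => -(expWeight q y / 2)) (|q t| * expWeight q t) t := by
    intro t _
    convert! ((h.hasDerivAt_expWeight t).div_const 2).neg using 1
    ring
  rw [intervalIntegral.integral_eq_sub_of_hasDerivAt hd
    ((h.cont.abs.mul h.continuous_expWeight).intervalIntegrable _ _)]
  have := expWeight_pos (q := q) (id b)
  linarith

end IsMajorant

/-- The operator `F ↦ ∫_x^∞ q(t) F(t, s) dt`. -/
def tailOp (q : ℝ → ℝ) (F : ℝ → ℝ → ℝ) (x s : ℝ) : ℝ :=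
  ∫ t in Ioi x, q t * F t s

/-- The operator `F ↦ -∫_x^{x+s/2} q(t) F(t, s - 2(t - x)) dt`. -/
def shearOp (q : ℝ → ℝ) (F : ℝ → ℝ → ℝ) (x s : ℝ) : ℝ :=
  -∫ t in Ioc x (x + s / 2), q t * F t (s - 2 * (t - x))

/-- Measurable kernels bounded by `C σ(x + s/2)` times the exponential weight. -/
structure KernelBound (q σ : ℝ → ℝ) (C : ℝ) (F : ℝ → ℝ → ℝ) : Prop where
  meas : Measurable (Function.uncurry F)
  le : ∀ x s, |F x s| ≤ C * σ (x + s / 2) * expWeight q x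

theorem measurable_tailOp {q : ℝ → ℝ} (hq : Measurable q) {F : ℝ → ℝ → ℝ}
    (hF : Measurable (Function.uncurry F)) : Measurable (Function.uncurry (tailOp q F)) := by
  have h1 : Measurable fun p : (ℝ × ℝ) × ℝ => q p.2 * F p.2 p.1.2 :=
    (hq.comp measurable_snd).mul (hF.comp (measurable_snd.prodMk measurable_fst.snd))
  have h2 := (h1.indicator (measurableSet_lt (measurable_fst.fst :
    Measurable fun p : (ℝ × ℝ) × ℝ => p.1.1) measurable_snd)).stronglyMeasurable
  have h3 := (h2.integral_prod_right' (ν := volume)).measurable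
  convert! h3 using 1
  ext p
  simp only [Function.uncurry, tailOp]
  rw [← integral_indicator measurableSet_Ioi]
  rfl

theorem measurable_shearOp {q : ℝ → ℝ} (hq : Measurable q) {F : ℝ → ℝ → ℝ}
    (hF : Measurable (Function.uncurry F)) : Measurable (Function.uncurry (shearOp q F)) := by
  have h1 : Measurable fun p : (ℝ × ℝ) × ℝ => q p.2 * F p.2 (p.1.2 - 2 * (p.2 - p.1.1)) :=
    (hq.comp measurable_snd).mul (hF.comp (measurable_snd.prodMk (by fun_prop)))
  have h2 := (h1.indicator ((measurableSet_lt (measurable_fst.fst :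
    Measurable fun p : (ℝ × ℝ) × ℝ => p.1.1) measurable_snd).inter
    (measurableSet_le measurable_snd (by fun_prop :
      Measurable fun p : (ℝ × ℝ) × ℝ => p.1.1 + p.1.2 / 2)))).stronglyMeasurable
  have h3 := (h2.integral_prod_right' (ν := volume)).measurable.neg
  convert! h3 using 1
  ext p
  simp only [Function.uncurry, shearOp, Pi.neg_apply]
  rw [← integral_indicator measurableSet_Ioc]
  rfl

namespace KernelBound

variable {q σ : ℝ → ℝ} {C : ℝ} {F : ℝ → ℝ → ℝ}

theorem measurable_right (hF : KernelBound q σ C F) (x : ℝ) : Measurable (F x) :=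
  hF.meas.comp measurable_prodMk_left

theorem norm_tail_le (hF : KernelBound q σ C F) (h : IsMajorant q σ) (hC : 0 ≤ C) {x t : ℝ}
    (hxt : x < t) (s : ℝ) :
    ‖q t * F t s‖ ≤ C * σ (x + s / 2) * (|q t| * expWeight q t) := by
  rw [norm_mul, Real.norm_eq_abs, Real.norm_eq_abs]
  have h1 : σ (t + s / 2) ≤ σ (x + s / 2) := h.anti (by linarith)
  have hE := (IsMajorant.expWeight_pos (q := q) t).le
  calc |q t| * |F t s| ≤ |q t| * (C * σ (t + s / 2) * expWeight q t) := by
        gcongr; exact hF.le t s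
    _ ≤ |q t| * (C * σ (x + s / 2) * expWeight q t) := by gcongr
    _ = _ := by ring

theorem norm_shear_le (hF : KernelBound q σ C F) (x t s : ℝ) :
    ‖q t * F t (s - 2 * (t - x))‖ ≤ C * σ (x + s / 2) * (|q t| * expWeight q t) := by
  rw [norm_mul, Real.norm_eq_abs, Real.norm_eq_abs]
  have h1 := hF.le t (s - 2 * (t - x))
  rw [show t + (s - 2 * (t - x)) / 2 = x + s / 2 by ring] at h1
  calc |q t| * |F t (s - 2 * (t - x))| ≤ |q t| * (C * σ (x + s / 2) * expWeight q t) := by gcongr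
    _ = _ := by ring

theorem tailOp (hF : KernelBound q σ C F) (h : IsMajorant q σ) (hC : 0 ≤ C) :
    KernelBound q σ (C / 2) (tailOp q F) where
  meas := measurable_tailOp h.cont.measurable hF.meas
  le x s := by
    have h1 := norm_integral_le_of_norm_le ((h.integrableOn_abs_mul_expWeight x).const_mul
      (C * σ (x + s / 2))) ((ae_restrict_iff' measurableSet_Ioi).2
        (Eventually.of_forall fun t ht => hF.norm_tail_le h hC ht s))
    rw [integral_const_mul] at h1
    have h2 := h.integral_abs_mul_expWeight_le x
    have h3 : 0 ≤ C * σ (x + s / 2) := mul_nonneg hC (h.nonneg _)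
    calc _ ≤ _ := h1
      _ ≤ C * σ (x + s / 2) * (expWeight q x / 2) := by gcongr
      _ = _ := by ring

theorem shearOp (hF : KernelBound q σ C F) (h : IsMajorant q σ) (hC : 0 ≤ C) :
    KernelBound q σ (C / 2) (shearOp q F) where
  meas := measurable_shearOp h.cont.measurable hF.meas
  le x s := by
    have hsub : Ioc x (x + s / 2) ⊆ Ioi x := fun t ht => ht.1
    have h3 : 0 ≤ C * σ (x + s / 2) := mul_nonneg hC (h.nonneg _)
    have hi := (h.integrableOn_abs_mul_expWeight x).const_mul (C * σ (x + s / 2))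
    have h1 := norm_integral_le_of_norm_le (IntegrableOn.mono_set hi hsub)
      (Eventually.of_forall fun t => hF.norm_shear_le x t s)
    have h4 := setIntegral_mono_set hi (Eventually.of_forall fun t => mul_nonneg h3
      (mul_nonneg (abs_nonneg _) (IsMajorant.expWeight_pos t).le)) hsub.eventuallyLE
    rw [integral_const_mul (μ := volume.restrict (Ioi x))] at h4
    have h2 := h.integral_abs_mul_expWeight_le x
    rw [ZS.shearOp, abs_neg]
    calc _ ≤ _ := h1
      _ ≤ _ := h4
      _ ≤ C * σ (x + s / 2) * (expWeight q x / 2) := by gcongr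
      _ = _ := by ring

theorem hasSum_tailOp {Fk : ℕ → ℝ → ℝ → ℝ} {c : ℕ → ℝ} (hF : ∀ k, KernelBound q σ (c k) (Fk k))
    (h : IsMajorant q σ) (hc0 : ∀ k, 0 ≤ c k) (hc : Summable c)
    (hs : ∀ x s, HasSum (fun k => Fk k x s) (F x s)) (x s : ℝ) :
    HasSum (fun k => ZS.tailOp q (Fk k) x s) (ZS.tailOp q F x s) := by
  refine hasSum_integral_of_dominated_convergence
    (fun k t => c k * σ (x + s / 2) * (|q t| * expWeight q t)) ?_ ?_ ?_ ?_ ?_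
  · intro k
    exact (h.cont.measurable.mul ((hF k).meas.comp measurable_prodMk_right)).aestronglyMeasurable
  · intro k
    exact (ae_restrict_iff' measurableSet_Ioi).2
        (Eventually.of_forall fun t ht => (hF k).norm_tail_le h (hc0 k) ht s)
  · exact Eventually.of_forall fun t => (hc.mul_right _).mul_right _
  · simp_rw [tsum_mul_right]
    exact (h.integrableOn_abs_mul_expWeight x).const_mul _
  · exact Eventually.of_forall fun t => (hs t s).mul_left _

theorem hasSum_shearOp {Fk : ℕ → ℝ → ℝ → ℝ} {c : ℕ → ℝ} (hF : ∀ k, KernelBound q σ (c k) (Fk k))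
    (h : IsMajorant q σ) (hc : Summable c)
    (hs : ∀ x s, HasSum (fun k => Fk k x s) (F x s)) (x s : ℝ) :
    HasSum (fun k => ZS.shearOp q (Fk k) x s) (ZS.shearOp q F x s) := by
  refine HasSum.neg (hasSum_integral_of_dominated_convergence
    (fun k t => c k * σ (x + s / 2) * (|q t| * expWeight q t)) ?_ ?_ ?_ ?_ ?_)
  · intro k
    exact (h.cont.measurable.mul ((hF k).meas.comp
      (measurable_id.prodMk (by fun_prop)))).aestronglyMeasurable
  · exact fun k => Eventually.of_forall fun t => (hF k).norm_shear_le x t s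
  · exact Eventually.of_forall fun t => (hc.mul_right _).mul_right _
  · simp_rw [tsum_mul_right]
    have hi := (h.integrableOn_abs_mul_expWeight x).const_mul ((∑' k, c k) * σ (x + s / 2))
    exact IntegrableOn.mono_set hi fun t ht => ht.1
  · exact Eventually.of_forall fun t => (hs t _).mul_left _

theorem tsum {Fk : ℕ → ℝ → ℝ → ℝ} {c : ℕ → ℝ} (hF : ∀ k, KernelBound q σ (c k) (Fk k))
    (hc : Summable c) :
    (∀ x s, HasSum (fun k => Fk k x s) (∑' k, Fk k x s)) ∧
      KernelBound q σ (∑' k, c k) fun x s => ∑' k, Fk k x s := by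
  have hb (x s : ℝ) : Summable fun k => c k * σ (x + s / 2) * expWeight q x :=
    (hc.mul_right _).mul_right _
  have hs (x s : ℝ) : Summable fun k => ‖Fk k x s‖ :=
    Summable.of_nonneg_of_le (fun _ => norm_nonneg _) (fun k => (hF k).le x s) (hb x s)
  have hS (x s : ℝ) := (hs x s).of_norm.hasSum
  refine ⟨hS, ?_, fun x s => ?_⟩
  · refine measurable_of_tendsto_metrizable (f := fun (n : ℕ) (p : ℝ × ℝ) =>
      ∑ k ∈ Finset.range n, Fk k p.1 p.2) (fun n => ?_) ?_
    · exact Finset.measurable_fun_sum _ fun k _ => (hF k).meas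
    · rw [tendsto_pi_nhds]
      exact fun p => (hS p.1 p.2).tendsto_sum_nat
  · rw [← tsum_mul_right, ← tsum_mul_right]
    exact tsum_of_norm_bounded (f := fun k => Fk k x s) (hb x s).hasSum fun k => (hF k).le x s

end KernelBound

/-- The successive approximations of the kernel of the first component. -/
def volterraIterate (q : ℝ → ℝ) : ℕ → ℝ → ℝ → ℝ
  | 0 => fun x s => -(q (x + s / 2) / 2)
  | k + 1 => shearOp q (tailOp q (volterraIterate q k))

/-- The transformation kernel of the first component of the right Jost solution. -/
def kernelV (q : ℝ → ℝ) (x s : ℝ) : ℝ := ∑' k, volterraIterate q k x s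

/-- The transformation kernel of the second component of the right Jost solution. -/
def kernelU (q : ℝ → ℝ) : ℝ → ℝ → ℝ := tailOp q (kernelV q)

theorem kernelBound_volterraIterate {q σ : ℝ → ℝ} (h : IsMajorant q σ) (k : ℕ) :
    KernelBound q σ (1 / 2 * (1 / 4) ^ k) (volterraIterate q k) := by
  induction k with
  | zero =>
    refine ⟨?_, fun x s => ?_⟩
    · exact ((h.cont.measurable.comp (by fun_prop : Measurable fun p : ℝ × ℝ => p.1 + p.2 / 2)).div_const 2).neg
    · have h1 := h.le (x + s / 2)
      have h2 := IsMajorant.one_le_expWeight (q := q) x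
      have h3 := h.nonneg (x + s / 2)
      simp only [volterraIterate, abs_neg, abs_div, abs_two, pow_zero]
      nlinarith
  | succ k ih =>
    have := (ih.tailOp h (by positivity)).shearOp h (by positivity)
    convert! this using 1
    ring

theorem summable_const_volterraIterate : Summable fun k : ℕ => (1 / 2 : ℝ) * (1 / 4) ^ k :=
  (summable_geometric_of_lt_one (by norm_num) (by norm_num)).mul_left _

theorem kernelBound_kernelV {q σ : ℝ → ℝ} (h : IsMajorant q σ) : KernelBound q σ (2 / 3) (kernelV q) := by
  have := (KernelBound.tsum (kernelBound_volterraIterate h) summable_const_volterraIterate).2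
  rw [tsum_mul_left, tsum_geometric_of_lt_one (by norm_num) (by norm_num)] at this
  convert! this using 1
  norm_num

theorem kernelBound_kernelU {q σ : ℝ → ℝ} (h : IsMajorant q σ) : KernelBound q σ (1 / 3) (kernelU q) := by
  have := (kernelBound_kernelV h).tailOp h (by norm_num)
  convert! this using 1
  norm_num

theorem kernelV_eq {q σ : ℝ → ℝ} (h : IsMajorant q σ) (x s : ℝ) :
    kernelV q x s = -(q (x + s / 2) / 2) + shearOp q (kernelU q) x s := by
  have hV := kernelBound_volterraIterate h
  have hs := (KernelBound.tsum hV summable_const_volterraIterate).1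
  have h1 := KernelBound.hasSum_tailOp hV h (fun k => by positivity) summable_const_volterraIterate hs
  have h2 := KernelBound.hasSum_shearOp (fun k => (hV k).tailOp h (by positivity)) h
    (summable_const_volterraIterate.div_const 2) h1 x s
  have h3 := (hs x s).summable.tsum_eq_zero_add
  exact h3.trans (congrArg _ h2.tsum_eq)

section HalfLine

variable {E : Type*} [NormedAddCommGroup E]

theorem preimage_add_const_Ioi (d : ℝ) : (fun s : ℝ => s + d) ⁻¹' Ioi d = Ioi 0 := by
  ext s; simp

theorem integrableOn_Ioi_zero_comp_add_iff (f : ℝ → E) (d : ℝ) :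
    IntegrableOn (fun s => f (s + d)) (Ioi 0) ↔ IntegrableOn f (Ioi d) := by
  rw [← preimage_add_const_Ioi d]
  exact (measurePreserving_add_right volume d).integrableOn_comp_preimage
    (measurableEmbedding_addRight d)

theorem integral_Ioi_zero_comp_add [NormedSpace ℝ E] (f : ℝ → E) (d : ℝ) :
    ∫ s in Ioi (0 : ℝ), f (s + d) = ∫ t in Ioi d, f t := by
  rw [← preimage_add_const_Ioi d]
  exact (measurePreserving_add_right volume d).setIntegral_preimage_emb
    (measurableEmbedding_addRight d) f (Ioi d)

theorem integrableOn_Ioi_zero_comp_add_half_iff (f : ℝ → E) (x : ℝ) :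
    IntegrableOn (fun s => f (x + s / 2)) (Ioi 0) ↔ IntegrableOn f (Ioi x) := by
  have h := integrableOn_Ioi_comp_mul_left_iff (fun s => f (s + x)) 0 (a := 1 / 2) (by norm_num)
  rw [mul_zero, integrableOn_Ioi_zero_comp_add_iff] at h
  rw [← h]
  refine integrableOn_congr_fun (fun s _ => ?_) measurableSet_Ioi
  congr 1; ring

theorem integral_Ioi_zero_comp_add_half [NormedSpace ℝ E] (f : ℝ → E) (x : ℝ) :
    ∫ s in Ioi (0 : ℝ), f (x + s / 2) = (2 : ℝ) • ∫ t in Ioi x, f t := by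
  have h := integral_comp_mul_left_Ioi (fun s => f (s + x)) 0 (b := 1 / 2) (by norm_num)
  rw [mul_zero, integral_Ioi_zero_comp_add] at h
  rw [show (2 : ℝ) = (1 / 2)⁻¹ by norm_num, ← h]
  congr 1; ext s; congr 1; ring

end HalfLine

theorem norm_cexp_I_mul (ρ : ℂ) (t : ℝ) :
    ‖Complex.exp (Complex.I * ρ * t)‖ = Real.exp (-(ρ.im * t)) := by
  simp [Complex.norm_exp]

theorem norm_cexp_I_mul_le_one {ρ : ℂ} (hρ : 0 ≤ ρ.im) {t : ℝ} (ht : 0 ≤ t) :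
    ‖Complex.exp (Complex.I * ρ * t)‖ ≤ 1 := by
  rw [norm_cexp_I_mul, Real.exp_le_one_iff]
  linarith [mul_nonneg hρ ht]

namespace KernelBound

variable {q σ : ℝ → ℝ} {C : ℝ} {F : ℝ → ℝ → ℝ}

theorem norm_le_ofReal (hF : KernelBound q σ C F) (x s : ℝ) :
    ‖(F x s : ℂ)‖ ≤ C * expWeight q x * σ (x + s / 2) := by
  rw [Complex.norm_real, Real.norm_eq_abs]
  exact (hF.le x s).trans_eq (by ring)

theorem integrableOn_majorant (h : IsMajorant q σ) (x : ℝ) :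
    IntegrableOn (fun s => C * expWeight q x * σ (x + s / 2)) (Ioi 0) :=
  ((integrableOn_Ioi_zero_comp_add_half_iff σ x).2 (h.int x)).const_mul _

theorem integrableOn_ofReal (hF : KernelBound q σ C F) (h : IsMajorant q σ) (x : ℝ) :
    IntegrableOn (fun s => (F x s : ℂ)) (Ioi 0) :=
  (integrableOn_majorant h x).mono'
    (Complex.measurable_ofReal.comp (hF.measurable_right x)).aestronglyMeasurable
    (Eventually.of_forall (hF.norm_le_ofReal x))

theorem memLp_two_ofReal (hF : KernelBound q σ C F) (h : IsMajorant q σ) (hC : 0 ≤ C) (x : ℝ) :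
    MemLp (fun s => (F x s : ℂ)) 2 (volume.restrict (Ioi 0)) := by
  have h1 := hF.integrableOn_ofReal h x
  rw [memLp_two_iff_integrable_sq_norm h1.1]
  refine (h1.norm.const_mul (C * expWeight q x * σ x)).mono' (h1.1.norm.pow 2) ?_
  filter_upwards [ae_restrict_mem measurableSet_Ioi] with s hs
  have hE := (IsMajorant.expWeight_pos (q := q) x).le
  rw [mem_Ioi] at hs
  have hσ : σ (x + s / 2) ≤ σ x := h.anti (by linarith)
  rw [Real.norm_of_nonneg (by positivity), pow_two]
  refine mul_le_mul_of_nonneg_right ((hF.norm_le_ofReal x s).trans ?_) (norm_nonneg _)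
  gcongr

theorem integrableOn_mul_cexp (hF : KernelBound q σ C F) (h : IsMajorant q σ) (x : ℝ) {ρ : ℂ}
    (hρ : 0 ≤ ρ.im) :
    IntegrableOn (fun s : ℝ => (F x s : ℂ) * Complex.exp (Complex.I * ρ * s)) (Ioi 0) := by
  refine (hF.integrableOn_ofReal h x).norm.mono' ?_ ?_
  · exact (hF.integrableOn_ofReal h x).1.mul
      (by fun_prop : Continuous fun s : ℝ => Complex.exp (Complex.I * ρ * s)).aestronglyMeasurable
  · filter_upwards [ae_restrict_mem measurableSet_Ioi] with s hs
    rw [norm_mul]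
    exact mul_le_of_le_one_right (norm_nonneg _) (norm_cexp_I_mul_le_one hρ (le_of_lt hs))

theorem norm_halfLineTransform_le (hF : KernelBound q σ C F) (h : IsMajorant q σ) (hC : 0 ≤ C)
    {ρ : ℂ} (hρ : 0 ≤ ρ.im) {x t : ℝ} (hxt : x ≤ t) :
    ‖halfLineTransform (fun s => (F t s : ℂ)) ρ‖
      ≤ ∫ s in Ioi (0 : ℝ), C * expWeight q x * σ (x + s / 2) := by
  refine norm_integral_le_of_norm_le (integrableOn_majorant h x) ?_
  filter_upwards [ae_restrict_mem measurableSet_Ioi] with s hs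
  rw [norm_mul]
  have h1 := mul_le_of_le_one_right (norm_nonneg (F t s : ℂ)) (norm_cexp_I_mul_le_one hρ (le_of_lt hs))
  refine (h1.trans (hF.norm_le_ofReal t s)).trans ?_
  have hE := h.antitone_expWeight hxt
  have hE0 := (IsMajorant.expWeight_pos (q := q) x).le
  have hs' : σ (t + s / 2) ≤ σ (x + s / 2) := h.anti (by linarith)
  have h0 := h.nonneg (t + s / 2)
  gcongr

theorem integrable_swap (h : IsMajorant q σ) (x : ℝ) {ρ : ℂ} (hρ : 0 ≤ ρ.im)
    {G : ℝ → ℝ → ℝ} (hGm : Measurable (Function.uncurry G))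
    (hG : ∀ s, ∀ t, x < t → |G s t| ≤ C * σ (x + s / 2) * (|q t| * expWeight q t)) :
    Integrable (Function.uncurry fun s t : ℝ => (G s t : ℂ) * Complex.exp (Complex.I * ρ * s))
      ((volume.restrict (Ioi 0)).prod (volume.restrict (Ioi x))) := by
  have h1 : IntegrableOn (fun s => C * σ (x + s / 2)) (Ioi 0) :=
    ((integrableOn_Ioi_zero_comp_add_half_iff σ x).2 (h.int x)).const_mul _
  refine (h1.mul_prod (h.integrableOn_abs_mul_expWeight x)).mono' ?_ ?_
  · refine ((Complex.measurable_ofReal.comp hGm).mul ?_).aestronglyMeasurable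
    exact (by fun_prop : Continuous fun p : ℝ × ℝ => Complex.exp (Complex.I * ρ * p.1)).measurable
  · rw [Measure.prod_restrict]
    filter_upwards [ae_restrict_mem (measurableSet_Ioi.prod measurableSet_Ioi)] with p hp
    rw [Function.uncurry, norm_mul, Complex.norm_real]
    exact (mul_le_of_le_one_right (norm_nonneg _)
      (norm_cexp_I_mul_le_one hρ (le_of_lt hp.1))).trans (hG p.1 p.2 hp.2)

theorem halfLineTransform_tailOp (hF : KernelBound q σ C F) (h : IsMajorant q σ) (hC : 0 ≤ C)
    (x : ℝ) {ρ : ℂ} (hρ : 0 ≤ ρ.im) :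
    IntegrableOn (fun t => (q t : ℂ) * halfLineTransform (fun s => (F t s : ℂ)) ρ) (Ioi x) ∧
    halfLineTransform (fun s => (ZS.tailOp q F x s : ℂ)) ρ
      = ∫ t in Ioi x, (q t : ℂ) * halfLineTransform (fun s => (F t s : ℂ)) ρ := by
  have hint := integrable_swap (G := fun s t => q t * F t s) h x hρ
    ((h.cont.measurable.comp measurable_snd).mul (hF.meas.comp measurable_swap))
    (fun s t ht => hF.norm_tail_le h hC ht s)
  have hin (t : ℝ) : ∫ s in Ioi (0 : ℝ), ((q t * F t s : ℝ) : ℂ) * Complex.exp (Complex.I * ρ * s)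
      = (q t : ℂ) * halfLineTransform (fun s => (F t s : ℂ)) ρ := by
    rw [halfLineTransform, ← integral_const_mul]
    congr 1; ext s; push_cast; ring
  constructor
  · have := hint.integral_prod_right
    simp only [Function.uncurry, hin] at this
    exact this
  · have := integral_integral_swap hint
    simp only [hin] at this
    rw [← this, halfLineTransform]
    congr 1; ext s
    rw [integral_mul_const, ZS.tailOp, integral_complex_ofReal]

theorem halfLineTransform_shearOp (hF : KernelBound q σ C F) (h : IsMajorant q σ)
    (x : ℝ) {ρ : ℂ} (hρ : 0 ≤ ρ.im) :
    IntegrableOn (fun t => (q t : ℂ) * halfLineTransform (fun s => (F t s : ℂ)) ρ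
      * Complex.exp (2 * Complex.I * ρ * (t - x))) (Ioi x) ∧
    halfLineTransform (fun s => (ZS.shearOp q F x s : ℂ)) ρ
      = -∫ t in Ioi x, (q t : ℂ) * halfLineTransform (fun s => (F t s : ℂ)) ρ
        * Complex.exp (2 * Complex.I * ρ * (t - x)) := by
  set G : ℝ → ℝ → ℝ := fun s t => (Iio (x + s / 2)).indicator (fun t => q t * F t (s - 2 * (t - x))) t with hG
  have hGm : Measurable (Function.uncurry G) := by
    have h1 : Measurable fun p : ℝ × ℝ => q p.2 * F p.2 (p.1 - 2 * (p.2 - x)) :=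
      (h.cont.measurable.comp measurable_snd).mul (hF.meas.comp (measurable_snd.prodMk (by fun_prop)))
    exact h1.indicator (measurableSet_lt measurable_snd (by fun_prop :
      Measurable fun p : ℝ × ℝ => x + p.1 / 2))
  have hint := integrable_swap (G := G) h x hρ hGm (fun s t _ => by
    refine le_trans ?_ (hF.norm_shear_le x t s)
    rw [hG, ← Real.norm_eq_abs]
    exact norm_indicator_le_norm_self _ _)
  have hin (t : ℝ) (ht : t ∈ Ioi x) :
      ∫ s in Ioi (0 : ℝ), (G s t : ℂ) * Complex.exp (Complex.I * ρ * s)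
      = (q t : ℂ) * halfLineTransform (fun s => (F t s : ℂ)) ρ
        * Complex.exp (2 * Complex.I * ρ * (t - x)) := by
    rw [mem_Ioi] at ht
    have h1 (s : ℝ) : (G s t : ℂ) * Complex.exp (Complex.I * ρ * s)
        = (Ioi (2 * (t - x))).indicator (fun s : ℝ => ((q t * F t (s - 2 * (t - x)) : ℝ) : ℂ)
          * Complex.exp (Complex.I * ρ * s)) s := by
      by_cases hs : 2 * (t - x) < s
      · rw [indicator_of_mem (mem_Ioi.2 hs), hG]
        simp only
        rw [indicator_of_mem (show t ∈ Iio (x + s / 2) by rw [mem_Iio]; linarith)]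
      · rw [indicator_of_notMem (by simpa using hs), hG]
        simp only
        rw [indicator_of_notMem (by rw [mem_Iio]; linarith)]
        simp
    simp_rw [h1]
    rw [setIntegral_indicator measurableSet_Ioi, inter_eq_self_of_subset_right
      (Ioi_subset_Ioi (by linarith)), ← integral_Ioi_zero_comp_add, halfLineTransform,
      ← integral_const_mul, ← integral_mul_const]
    congr 1; ext s
    rw [add_sub_cancel_right, show Complex.I * ρ * ((s + 2 * (t - x) : ℝ) : ℂ)
      = Complex.I * ρ * s + 2 * Complex.I * ρ * (t - x) by push_cast; ring, Complex.exp_add]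
    push_cast; ring
  constructor
  · have := hint.integral_prod_right
    refine this.congr ?_
    filter_upwards [ae_restrict_mem measurableSet_Ioi] with t ht
    exact hin t ht
  · have := integral_integral_swap hint
    rw [setIntegral_congr_fun measurableSet_Ioi hin] at this
    rw [← this, halfLineTransform, ← integral_neg]
    congr 1; ext s
    rw [integral_mul_const, ZS.shearOp, hG, integral_Ioc_eq_integral_Ioo, integral_complex_ofReal,
      setIntegral_indicator measurableSet_Iio, Ioi_inter_Iio]
    push_cast; ring

end KernelBound

theorem transform_kernelU {q σ : ℝ → ℝ} (h : IsMajorant q σ) (x : ℝ) {ρ : ℂ} (hρ : 0 ≤ ρ.im) :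
    IntegrableOn (fun t => (q t : ℂ) * halfLineTransform (fun s => (kernelV q t s : ℂ)) ρ) (Ioi x) ∧
    halfLineTransform (fun s => (kernelU q x s : ℂ)) ρ
      = ∫ t in Ioi x, (q t : ℂ) * halfLineTransform (fun s => (kernelV q t s : ℂ)) ρ :=
  (kernelBound_kernelV h).halfLineTransform_tailOp h (by norm_num) x hρ

theorem transform_kernelV {q σ : ℝ → ℝ} (h : IsMajorant q σ) (x : ℝ) {ρ : ℂ} (hρ : 0 ≤ ρ.im) :
    IntegrableOn (fun t => (q t : ℂ) * (1 + halfLineTransform (fun s => (kernelU q t s : ℂ)) ρ)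
      * Complex.exp (2 * Complex.I * ρ * (t - x))) (Ioi x) ∧
    halfLineTransform (fun s => (kernelV q x s : ℂ)) ρ
      = -∫ t in Ioi x, (q t : ℂ) * (1 + halfLineTransform (fun s => (kernelU q t s : ℂ)) ρ)
        * Complex.exp (2 * Complex.I * ρ * (t - x)) := by
  have hU := kernelBound_kernelU h
  obtain ⟨hi, he⟩ := hU.halfLineTransform_shearOp h x hρ
  set g : ℝ → ℂ := fun t => (q t : ℂ) * Complex.exp (2 * Complex.I * ρ * (t - x)) with hg
  have hgi : IntegrableOn g (Ioi x) := by
    refine (h.integrableOn x).norm.mono' ?_ ?_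
    · have := h.cont
      exact (by fun_prop : Continuous g).aestronglyMeasurable
    · filter_upwards [ae_restrict_mem measurableSet_Ioi] with t ht
      rw [mem_Ioi] at ht
      rw [hg, norm_mul, Complex.norm_real]
      refine mul_le_of_le_one_right (norm_nonneg _) ?_
      have := norm_cexp_I_mul_le_one hρ (t := 2 * (t - x)) (by linarith)
      convert! this using 3
      push_cast; ring
  have hsum (t : ℝ) : (q t : ℂ) * (1 + halfLineTransform (fun s => (kernelU q t s : ℂ)) ρ)
      * Complex.exp (2 * Complex.I * ρ * (t - x))
      = g t + (q t : ℂ) * halfLineTransform (fun s => (kernelU q t s : ℂ)) ρ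
        * Complex.exp (2 * Complex.I * ρ * (t - x)) := by rw [hg]; ring
  simp_rw [hsum]
  refine ⟨hgi.add hi, ?_⟩
  rw [integral_add hgi hi, neg_add, ← he]
  have hgs : ∫ t in Ioi x, g t
      = ∫ s in Ioi (0 : ℝ), ((q (x + s / 2) / 2 : ℝ) : ℂ) * Complex.exp (Complex.I * ρ * s) := by
    have h2 := integral_Ioi_zero_comp_add_half g x
    have h3 : ∫ t in Ioi x, g t = (1 / 2 : ℂ) * ∫ s in Ioi (0 : ℝ), g (x + s / 2) := by
      rw [h2, Complex.real_smul]; push_cast; ring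
    rw [h3, ← integral_const_mul]
    congr 1; ext s
    rw [hg]
    simp only
    rw [show 2 * Complex.I * ρ * (((x + s / 2 : ℝ) : ℂ) - x) = Complex.I * ρ * s by push_cast; ring]
    push_cast; ring
  have hgint : IntegrableOn (fun s : ℝ => ((q (x + s / 2) / 2 : ℝ) : ℂ)
      * Complex.exp (Complex.I * ρ * s)) (Ioi 0) := by
    have := (kernelBound_volterraIterate h 0).integrableOn_mul_cexp h x hρ
    refine this.neg.congr (Eventually.of_forall fun s => ?_)
    simp [volterraIterate]
  have hsint := (hU.shearOp h (by norm_num)).integrableOn_mul_cexp h x hρ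
  rw [hgs, halfLineTransform, halfLineTransform, ← integral_neg]
  refine Eq.trans ?_ (integral_add hgint.neg hsint)
  congr 1; ext s
  rw [kernelV_eq h]
  push_cast; ring

theorem exists_bound_Ici_of_tendsto {f : ℝ → ℂ} (hf : Continuous f) {L : ℂ}
    (hL : Tendsto f atTop (𝓝 L)) (x : ℝ) : ∃ M, 0 ≤ M ∧ ∀ t, x ≤ t → ‖f t‖ ≤ M := by
  have h1 : ∀ᶠ t in atTop, ‖f t‖ < ‖L‖ + 1 := hL.norm.eventually_lt_const (by linarith)
  obtain ⟨b, hb⟩ := eventually_atTop.1 h1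
  obtain ⟨M, hM⟩ := (isCompact_Icc (a := x) (b := b)).exists_bound_of_continuousOn hf.continuousOn
  refine ⟨max M (‖L‖ + 1), le_max_of_le_right (by positivity), fun t ht => ?_⟩
  rcases le_total t b with htb | htb
  · exact (hM t ⟨ht, htb⟩).trans (le_max_left _ _)
  · exact (hb t htb).le.trans (le_max_right _ _)

theorem norm_integral_le_expWeight {q σ : ℝ → ℝ} (h : IsMajorant q σ) {K : ℝ} (hK : 0 ≤ K) {x : ℝ}
    {f b : ℝ → ℂ} (hf : ∀ t, x < t → ‖f t‖ ≤ |q t| * ‖b t‖)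
    (hb : ∀ t, x < t → ‖b t‖ ≤ K * expWeight q t) :
    ‖∫ t in Ioi x, f t‖ ≤ K / 2 * expWeight q x := by
  have h1 := norm_integral_le_of_norm_le (f := f) ((h.integrableOn_abs_mul_expWeight x).const_mul K)
    ((ae_restrict_iff' measurableSet_Ioi).2 (Eventually.of_forall fun t ht => by
      calc ‖f t‖ ≤ |q t| * ‖b t‖ := hf t ht
        _ ≤ |q t| * (K * expWeight q t) := by gcongr; exact hb t ht
        _ = _ := by ring))
  rw [integral_const_mul] at h1
  calc _ ≤ _ := h1
    _ ≤ K * (expWeight q x / 2) := by gcongr; exact h.integral_abs_mul_expWeight_le x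
    _ = _ := by ring

theorem eq_zero_of_volterra {q σ : ℝ → ℝ} (h : IsMajorant q σ) {x₀ M : ℝ} {a b f g : ℝ → ℂ}
    {E : ℝ → ℝ → ℂ} (hE : ∀ x t, x ≤ t → ‖E x t‖ ≤ 1)
    (hf : ∀ x, x₀ ≤ x → a x = ∫ t in Ioi x, f t * b t) (hfq : ∀ t, ‖f t‖ ≤ |q t|)
    (hg : ∀ x, x₀ ≤ x → b x = ∫ t in Ioi x, g t * a t * E x t) (hgq : ∀ t, ‖g t‖ ≤ |q t|)
    (hM : 0 ≤ M) (ha : ∀ t, x₀ ≤ t → ‖a t‖ ≤ M) (hb : ∀ t, x₀ ≤ t → ‖b t‖ ≤ M)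
    {x : ℝ} (hx : x₀ ≤ x) : a x = 0 ∧ b x = 0 := by
  have hn : ∀ n : ℕ, ∀ t, x₀ ≤ t → ‖a t‖ ≤ M * (1 / 2) ^ n * expWeight q t ∧
      ‖b t‖ ≤ M * (1 / 2) ^ n * expWeight q t := by
    intro n
    induction n with
    | zero =>
      intro t ht
      have h1 := IsMajorant.one_le_expWeight (q := q) t
      have h2 : M ≤ M * (1 / 2) ^ 0 * expWeight q t := by
        rw [pow_zero, mul_one]; exact le_mul_of_one_le_right hM h1
      exact ⟨(ha t ht).trans h2, (hb t ht).trans h2⟩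
    | succ n ih =>
      intro t ht
      have hK : 0 ≤ M * (1 / 2) ^ n := by positivity
      have hpow : M * (1 / 2) ^ (n + 1) = M * (1 / 2) ^ n / 2 := by rw [pow_succ]; ring
      rw [hpow]
      constructor
      · rw [hf t ht]
        refine norm_integral_le_expWeight h (b := b) hK (fun s _ => ?_)
          (fun s hs => (ih s (ht.trans hs.le)).2)
        rw [norm_mul]
        gcongr
        exact hfq s
      · rw [hg t ht]
        refine norm_integral_le_expWeight h (b := a) hK (fun s hs => ?_)
          (fun s hs => (ih s (ht.trans hs.le)).1)
        rw [norm_mul, norm_mul]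
        refine (mul_le_of_le_one_right (by positivity) (hE t s hs.le)).trans ?_
        gcongr
        exact hgq s
  have hlim : Tendsto (fun n : ℕ => M * (1 / 2) ^ n * expWeight q x) atTop (𝓝 0) := by
    have := ((tendsto_pow_atTop_nhds_zero_of_lt_one (r := (1 / 2 : ℝ)) (by norm_num)
      (by norm_num)).const_mul M).mul_const (expWeight q x)
    simpa using this
  exact ⟨norm_le_zero_iff.1 (ge_of_tendsto' hlim fun n => (hn n x hx).1),
    norm_le_zero_iff.1 (ge_of_tendsto' hlim fun n => (hn n x hx).2)⟩

theorem hasDerivAt_cexp_const_mul (c : ℂ) (x : ℝ) :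
    HasDerivAt (fun t : ℝ => Complex.exp (c * t)) (c * Complex.exp (c * x)) x := by
  have h1 : HasDerivAt (fun t : ℝ => c * (t : ℂ)) (c * 1) x :=
    (Complex.ofRealCLM.hasDerivAt (x := x)).const_mul c
  convert! h1.cexp using 1; ring

/-- The integral equations of the right Jost solution. -/
theorem integral_equations_of_isRightJostZS {q σ : ℝ → ℝ} (h : IsMajorant q σ) {ρ : ℂ}
    (hρ : 0 ≤ ρ.im) {n₁ n₂ : ℝ → ℂ} (hn : IsRightJostZS q ρ n₁ n₂) (x : ℝ) :
    (IntegrableOn (fun t : ℝ => (q t : ℂ) * (n₁ t * Complex.exp (-(Complex.I * ρ * t)))) (Ioi x) ∧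
      n₂ x * Complex.exp (-(Complex.I * ρ * x))
        = 1 + ∫ t in Ioi x, (q t : ℂ) * (n₁ t * Complex.exp (-(Complex.I * ρ * t)))) ∧
    (IntegrableOn (fun t : ℝ => (q t : ℂ) * (n₂ t * Complex.exp (-(Complex.I * ρ * t)))
        * Complex.exp (2 * Complex.I * ρ * (t - x))) (Ioi x) ∧
      n₁ x * Complex.exp (-(Complex.I * ρ * x))
        = -∫ t in Ioi x, (q t : ℂ) * (n₂ t * Complex.exp (-(Complex.I * ρ * t)))
          * Complex.exp (2 * Complex.I * ρ * (t - x))) := by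
  obtain ⟨⟨hd1, hd2⟩, hl1, hl2⟩ := hn
  have hc1 : Continuous n₁ := continuous_iff_continuousAt.2 fun x => (hd1 x).continuousAt
  have hc2 : Continuous n₂ := continuous_iff_continuousAt.2 fun x => (hd2 x).continuousAt
  set v : ℝ → ℂ := fun t => n₁ t * Complex.exp (-(Complex.I * ρ * t)) with hv
  set u : ℝ → ℂ := fun t => n₂ t * Complex.exp (-(Complex.I * ρ * t)) with hu
  have hcq : Continuous fun t => (q t : ℂ) := Complex.continuous_ofReal.comp h.cont
  have hcv : Continuous v := by fun_prop
  have hcu : Continuous u := by fun_prop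
  obtain ⟨Mv, hMv0, hMv⟩ := exists_bound_Ici_of_tendsto hcv hl1 x
  obtain ⟨Mu, hMu0, hMu⟩ := exists_bound_Ici_of_tendsto hcu hl2 x
  have hint {f : ℝ → ℂ} {M : ℝ} (hf : Continuous f) (hM : ∀ t, x ≤ t → ‖f t‖ ≤ M) :
      IntegrableOn (fun t => (q t : ℂ) * f t) (Ioi x) := by
    refine ((h.integrableOn x).norm.mul_const M).mono' (hcq.mul hf).aestronglyMeasurable ?_
    filter_upwards [ae_restrict_mem measurableSet_Ioi] with t ht
    rw [norm_mul, Complex.norm_real]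
    gcongr
    exact hM t (le_of_lt ht)
  have hexp (t : ℝ) : HasDerivAt (fun t : ℝ => Complex.exp (-(Complex.I * ρ * t)))
      (-(Complex.I * ρ) * Complex.exp (-(Complex.I * ρ * t))) t := by
    have := hasDerivAt_cexp_const_mul (-(Complex.I * ρ)) t
    simpa only [neg_mul] using this
  have hiv := hint hcv hMv
  refine ⟨⟨hiv, ?_⟩, ?_⟩
  · have hdu (t : ℝ) : HasDerivAt u (-((q t : ℂ) * v t)) t := by
      convert! (hd2 t).mul (hexp t) using 1
      rw [hv]; ring
    have h1 := integral_Ioi_of_hasDerivAt_of_tendsto' (fun t (_ : t ∈ Ici x) => hdu t) hiv.neg hl2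
    rw [integral_neg] at h1
    linear_combination h1
  · set W : ℝ → ℂ := fun t => n₁ t * Complex.exp (Complex.I * ρ * (t - 2 * x)) with hW
    have hWv (t : ℝ) : W t = v t * Complex.exp (2 * Complex.I * ρ * (t - x)) := by
      rw [hW, hv]
      simp only
      rw [mul_assoc (n₁ t), ← Complex.exp_add]
      congr 2; ring
    have hE (t : ℝ) (ht : x ≤ t) : ‖Complex.exp (2 * Complex.I * ρ * (t - x))‖ ≤ 1 := by
      have := norm_cexp_I_mul_le_one hρ (t := 2 * (t - x)) (by linarith)
      convert! this using 3
      push_cast; ring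
    have hWl : Tendsto W atTop (𝓝 0) := by
      refine squeeze_zero_norm' ?_ (by simpa using hl1.norm)
      filter_upwards [eventually_ge_atTop x] with t ht
      rw [hWv, norm_mul]
      exact mul_le_of_le_one_right (norm_nonneg _) (hE t ht)
    have hexp2 (t : ℝ) : HasDerivAt (fun t : ℝ => Complex.exp (Complex.I * ρ * (t - 2 * x)))
        (Complex.I * ρ * Complex.exp (Complex.I * ρ * (t - 2 * x))) t := by
      have h1 := (hasDerivAt_cexp_const_mul (Complex.I * ρ) t).mul_const
        (Complex.exp (-(Complex.I * ρ * (2 * x))))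
      convert! h1 using 1
      · ext t; rw [← Complex.exp_add]; congr 1; ring
      · rw [mul_assoc (Complex.I * ρ), ← Complex.exp_add]; congr 2; ring_nf
    have hdW (t : ℝ) : HasDerivAt W ((q t : ℂ) * u t * Complex.exp (2 * Complex.I * ρ * (t - x))) t := by
      convert! (hd1 t).mul (hexp2 t) using 1
      rw [hu]
      simp only
      rw [mul_assoc (q t : ℂ), mul_assoc (n₂ t), ← Complex.exp_add,
        show -(Complex.I * ρ * (t : ℂ)) + 2 * Complex.I * ρ * (t - x)
          = Complex.I * ρ * (t - 2 * x) by ring]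
      ring
    have hi : IntegrableOn (fun t : ℝ => (q t : ℂ) * u t * Complex.exp (2 * Complex.I * ρ * (t - x)))
        (Ioi x) := by
      have := hint (f := fun t => u t * Complex.exp (2 * Complex.I * ρ * (t - x))) (M := Mu)
        (by fun_prop) (fun t ht => by
          rw [norm_mul]
          exact (mul_le_of_le_one_right (norm_nonneg _) (hE t ht)).trans (hMu t ht))
      simpa only [mul_assoc] using this
    refine ⟨hi, ?_⟩
    have h1 := integral_Ioi_of_hasDerivAt_of_tendsto' (fun t (_ : t ∈ Ici x) => hdW t) hi hWl
    rw [h1, hWv x]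
    simp [hv]

/-- The transformation operator representation of the right Jost solution. -/
theorem eq_transform_of_isRightJostZS {q σ : ℝ → ℝ} (h : IsMajorant q σ) {ρ : ℂ}
    (hρ : 0 ≤ ρ.im) {n₁ n₂ : ℝ → ℂ} (hn : IsRightJostZS q ρ n₁ n₂) (x : ℝ) :
    n₂ x = Complex.exp (Complex.I * ρ * x)
      * (1 + halfLineTransform (fun s => (kernelU q x s : ℂ)) ρ) ∧
    n₁ x = Complex.exp (Complex.I * ρ * x)
      * halfLineTransform (fun s => (kernelV q x s : ℂ)) ρ := by
  have hd1 := hn.1.1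
  have hd2 := hn.1.2
  have hc1 : Continuous n₁ := continuous_iff_continuousAt.2 fun x => (hd1 x).continuousAt
  have hc2 : Continuous n₂ := continuous_iff_continuousAt.2 fun x => (hd2 x).continuousAt
  have heq := integral_equations_of_isRightJostZS h hρ hn
  obtain ⟨Mv, hMv0, hMv⟩ := exists_bound_Ici_of_tendsto
    (f := fun t => n₁ t * Complex.exp (-(Complex.I * ρ * t))) (by fun_prop) hn.2.1 x
  obtain ⟨Mu, hMu0, hMu⟩ := exists_bound_Ici_of_tendsto
    (f := fun t => n₂ t * Complex.exp (-(Complex.I * ρ * t))) (by fun_prop) hn.2.2 x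
  set v : ℝ → ℂ := fun t => n₁ t * Complex.exp (-(Complex.I * ρ * t)) with hv
  set u : ℝ → ℂ := fun t => n₂ t * Complex.exp (-(Complex.I * ρ * t)) with hu
  set U : ℝ → ℂ := fun t => halfLineTransform (fun s => (kernelU q t s : ℂ)) ρ with hU
  set V : ℝ → ℂ := fun t => halfLineTransform (fun s => (kernelV q t s : ℂ)) ρ with hV
  have hBU (t : ℝ) (ht : x ≤ t) :=
    (kernelBound_kernelU h).norm_halfLineTransform_le h (by norm_num) hρ ht
  have hBV (t : ℝ) (ht : x ≤ t) :=
    (kernelBound_kernelV h).norm_halfLineTransform_le h (by norm_num) hρ ht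
  set BU := ∫ s in Ioi (0 : ℝ), 1 / 3 * expWeight q x * σ (x + s / 2)
  set BV := ∫ s in Ioi (0 : ℝ), 2 / 3 * expWeight q x * σ (x + s / 2)
  have hBU0 : 0 ≤ BU := (norm_nonneg _).trans (hBU x le_rfl)
  have hBV0 : 0 ≤ BV := (norm_nonneg _).trans (hBV x le_rfl)
  have key := eq_zero_of_volterra h (x₀ := x) (M := Mv + BV + Mu + 1 + BU)
    (a := fun t => u t - (1 + U t)) (b := fun t => v t - V t) (f := fun t => (q t : ℂ))
    (g := fun t => -(q t : ℂ)) (E := fun x t => Complex.exp (2 * Complex.I * ρ * (t - x)))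
    (fun x t ht => by
      have := norm_cexp_I_mul_le_one hρ (t := 2 * (t - x)) (by linarith)
      convert! this using 3
      push_cast; ring)
    (fun y _ => by
      obtain ⟨hi1, he1⟩ := (heq y).1
      obtain ⟨hi2, he2⟩ := transform_kernelU h y hρ
      have hsub : ∫ t in Ioi y, (q t : ℂ) * (v t - V t) = _ :=
        (integral_congr_ae (Eventually.of_forall fun t => mul_sub (q t : ℂ) (v t) (V t))).trans
          (integral_sub hi1 hi2)
      rw [hsub]
      linear_combination he1 - he2)
    (fun t => by simp)
    (fun y _ => by
      obtain ⟨hi1, he1⟩ := (heq y).2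
      obtain ⟨hi2, he2⟩ := transform_kernelV h y hρ
      have hsub : ∫ t in Ioi y, -(q t : ℂ) * (u t - (1 + U t))
          * Complex.exp (2 * Complex.I * ρ * (t - y)) = _ :=
        (integral_congr_ae (Eventually.of_forall fun t => by ring)).trans (integral_sub hi2 hi1)
      rw [hsub]
      linear_combination he1 - he2)
    (fun t => by simp) (by positivity)
    (fun t ht => by
      refine (norm_sub_le _ _).trans ?_
      have h1 := norm_add_le 1 (U t)
      rw [norm_one] at h1
      linarith [hMu t ht, hBU t ht])
    (fun t ht => by
      refine (norm_sub_le _ _).trans ?_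
      linarith [hMv t ht, hBV t ht]) le_rfl
  have hexp : Complex.exp (Complex.I * ρ * x) * Complex.exp (-(Complex.I * ρ * x)) = 1 := by
    rw [← Complex.exp_add]; simp
  constructor
  · change n₂ x = Complex.exp (Complex.I * ρ * x) * (1 + U x)
    rw [← sub_eq_zero.1 key.1, hu]
    linear_combination (-n₂ x) * hexp
  · change n₁ x = Complex.exp (Complex.I * ρ * x) * V x
    rw [← sub_eq_zero.1 key.2, hv]
    linear_combination (-n₁ x) * hexp

theorem continuousAt_deriv_of_contDiffAt {q : ℝ → ℝ} {x : ℝ} (hq : ContDiffAt ℝ 1 q x) :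
    ContinuousAt (deriv q) x := by
  have h1 : ContinuousAt (fderiv ℝ q) x := (hq.fderiv_right (m := 0) (by norm_num)).continuousAt
  have h2 := h1.clm_apply (continuousAt_const (y := (1 : ℝ)))
  simpa only [fderiv_apply_one_eq_deriv] using h2

theorem measurable_schrPotential {q : ℝ → ℝ} (hq : Continuous q) : Measurable (schrPotential q) :=
  ((Complex.measurable_ofReal.comp (measurable_deriv q)).const_mul _).neg.sub
    ((Complex.measurable_ofReal.comp hq.measurable).pow_const 2)

theorem integrable_schrPotential {q : ℝ → ℝ} (hq2 : Integrable fun x => q x ^ 2)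
    (hq' : Integrable (deriv q)) : Integrable (schrPotential q) := by
  have h1 := (hq'.ofReal (𝕜 := ℂ)).const_mul Complex.I
  have h2 := hq2.ofReal (𝕜 := ℂ)
  refine (h1.neg.sub h2).congr (Eventually.of_forall fun x => ?_)
  simp [schrPotential]

/-- A right Jost solution of the Zakharov-Shabat system gives a right Jost solution of the
Schrödinger equation. -/
theorem IsRightJostZS.isRightJostSchr {q : ℝ → ℝ} (hq : PiecewiseC1 q)
    (hq2 : Integrable fun x => q x ^ 2) (hq' : Integrable (deriv q)) {ρ : ℂ} {n₁ n₂ : ℝ → ℂ}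
    (hn : IsRightJostZS q ρ n₁ n₂) :
    IsRightJostSchr (schrPotential q) ρ (fun x => n₂ x - Complex.I * n₁ x) := by
  obtain ⟨⟨hd1, hd2⟩, hl1, hl2⟩ := hn
  have hde (x : ℝ) : HasDerivAt (fun x => n₂ x - Complex.I * n₁ x)
      (-(ρ * (n₁ x - Complex.I * n₂ x)) - Complex.I * q x * (n₂ x - Complex.I * n₁ x)) x := by
    convert! (hd2 x).sub ((hd1 x).const_mul Complex.I) using 1
    linear_combination (q x * n₁ x - ρ * n₁ x) * Complex.I_sq
  have hc1 : Continuous n₁ := continuous_iff_continuousAt.2 fun x => (hd1 x).continuousAt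
  have hc2 : Continuous n₂ := continuous_iff_continuousAt.2 fun x => (hd2 x).continuousAt
  have hcq : Continuous fun x => (q x : ℂ) := Complex.continuous_ofReal.comp hq.1
  obtain ⟨S, hS, hd⟩ := hq.exists_countable
  refine ⟨⟨_, hde, fun a b => ?_⟩, ?_⟩
  · have hi : IntervalIntegrable (fun t => (schrPotential q t - ρ ^ 2) * (n₂ t - Complex.I * n₁ t))
        volume a b :=
      ((integrable_schrPotential hq2 hq').intervalIntegrable.sub
        intervalIntegrable_const).mul_continuousOn (by fun_prop)
    refine ⟨hi, ?_⟩
    refine (integral_eq_of_hasDerivAt_off_countable (fun x => -(ρ * (n₁ x - Complex.I * n₂ x))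
      - Complex.I * q x * (n₂ x - Complex.I * n₁ x)) _ hS (by fun_prop) (fun x hx => ?_) hi).symm
    have hqx : HasDerivAt (fun x => (q x : ℂ)) (deriv q x : ℝ) x :=
      ((hd x hx.2).differentiableAt (by norm_num)).hasDerivAt.ofReal_comp
    have h1 := (((hd1 x).sub ((hd2 x).const_mul Complex.I)).const_mul ρ).neg
    have h2 := (hqx.const_mul Complex.I).mul (hde x)
    convert! h1.sub h2 using 1
    simp only [schrPotential]
    linear_combination (-(ρ ^ 2 * n₂ x) + q x * ρ * n₂ x - q x * q x * (n₂ x - Complex.I * n₁ x)) * Complex.I_sq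
  · have := hl2.sub (hl1.const_mul Complex.I)
    rw [mul_zero, sub_zero] at this
    refine this.congr fun x => ?_
    ring

theorem hasDerivAt_of_off_countable {P h : ℝ → ℂ} (hP : Continuous P) (hh : Continuous h)
    {S : Set ℝ} (hS : S.Countable) (hd : ∀ x, x ∉ S → HasDerivAt P (h x) x) (x : ℝ) :
    HasDerivAt P (h x) x := by
  have h1 : P = fun y => P x + ∫ t in x..y, h t := by
    ext y
    rw [integral_eq_of_hasDerivAt_off_countable P h hS hP.continuousOn (fun z hz => hd z hz.2)
      (hh.intervalIntegrable _ _)]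
    ring
  rw [h1]
  exact (hh.integral_hasStrictDerivAt x x).hasDerivAt.const_add _

theorem eq_zero_of_tendsto_deriv {f f' : ℝ → ℂ} (hf : ∀ x, HasDerivAt f (f' x) x) {a L : ℂ}
    (ha : Tendsto f atTop (𝓝 a)) (hL : Tendsto f' atTop (𝓝 L)) : L = 0 := by
  have h1 : Tendsto (fun x => f (x + 1) - f x - L) atTop (𝓝 (-L)) := by
    have := ((ha.comp (tendsto_atTop_add_const_right atTop (1 : ℝ) tendsto_id)).sub ha).sub_const L
    simpa using this
  have h2 : Tendsto (fun x => f (x + 1) - f x - L) atTop (𝓝 0) := by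
    rw [Metric.tendsto_atTop]
    intro ε hε
    obtain ⟨N, hN⟩ := Metric.tendsto_atTop.1 hL (ε / 2) (half_pos hε)
    refine ⟨N, fun x hx => ?_⟩
    have hd (t : ℝ) : HasDerivAt (fun t : ℝ => f t - L * t) (f' t - L) t := by
      have := (hf t).sub ((Complex.ofRealCLM.hasDerivAt (x := t)).const_mul L)
      convert! this using 1
      simp
    have h3 := (convex_Icc x (x + 1)).norm_image_sub_le_of_norm_hasDerivWithin_le (C := ε / 2)
      (fun t _ => (hd t).hasDerivWithinAt) (fun t ht => by
        have := (hN t (hx.le.trans ht.1)).le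
        rwa [dist_eq_norm] at this) (left_mem_Icc.2 (by linarith)) (right_mem_Icc.2 (by linarith))
    have h4 : f (x + 1) - f x - L = f (x + 1) - L * ((x + 1 : ℝ) : ℂ) - (f x - L * x) := by
      push_cast; ring
    rw [dist_zero_right, h4]
    refine h3.trans_lt ?_
    rw [add_sub_cancel_left, norm_one, mul_one]
    linarith
  have := tendsto_nhds_unique h1 h2
  simpa using this

/-- The derivative of a right Jost solution of the Schrödinger equation has the asymptotics
obtained by formal differentiation. -/
theorem tendsto_deriv_of_isRightJostSchr {Q : ℝ → ℂ} (hQ : Integrable Q) {ρ : ℂ} (hρ : 0 < ρ.im)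
    {e de : ℝ → ℂ} (hde : ∀ x, HasDerivAt e (de x) x) (hdec : Continuous de)
    (hint : ∀ a b : ℝ, de b - de a = ∫ t in a..b, (Q t - ρ ^ 2) * e t)
    {S : Set ℝ} (hS : S.Countable) (hdde : ∀ x, x ∉ S → HasDerivAt de ((Q x - ρ ^ 2) * e x) x)
    (hl : Tendsto (fun x : ℝ => e x * Complex.exp (-(Complex.I * ρ * x))) atTop (𝓝 1)) :
    Tendsto (fun x : ℝ => de x * Complex.exp (-(Complex.I * ρ * x))) atTop (𝓝 (Complex.I * ρ)) := by
  have hec : Continuous e := continuous_iff_continuousAt.2 fun x => (hde x).continuousAt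
  set ζ : ℝ → ℂ := fun x => e x * Complex.exp (-(Complex.I * ρ * x)) with hζ
  have hζc : Continuous ζ := by fun_prop
  obtain ⟨M, hM0, hM⟩ := exists_bound_Ici_of_tendsto hζc hl 0
  have heζ (x : ℝ) : e x = ζ x * Complex.exp (Complex.I * ρ * x) := by
    rw [hζ]; simp only; rw [mul_assoc, ← Complex.exp_add]; simp
  have hexp0 : Tendsto (fun x : ℝ => Complex.exp (Complex.I * ρ * x)) atTop (𝓝 0) := by
    rw [tendsto_zero_iff_norm_tendsto_zero]
    simp_rw [norm_cexp_I_mul]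
    exact Real.tendsto_exp_neg_atTop_nhds_zero.comp (tendsto_id.const_mul_atTop hρ)
  have he0 : Tendsto e atTop (𝓝 0) := by
    have := hl.mul hexp0
    rw [mul_zero] at this
    exact this.congr fun x => (heζ x).symm
  have hQm := hQ.aestronglyMeasurable
  have hexpi : IntegrableOn (fun x : ℝ => Real.exp (-(ρ.im * x))) (Ioi 0) := by
    simpa using integrableOn_pow_mul_exp_neg hρ 0
  have hi1 : IntegrableOn (fun t => (Q t - ρ ^ 2) * e t) (Ioi 0) := by
    refine ((hQ.norm.const_mul M).integrableOn.add (hexpi.const_mul (‖ρ ^ 2‖ * M))).mono'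
      ((hQm.sub aestronglyMeasurable_const).mul hec.aestronglyMeasurable).restrict ?_
    filter_upwards [ae_restrict_mem measurableSet_Ioi] with t ht
    rw [mem_Ioi] at ht
    have h1 : ‖e t‖ ≤ M * Real.exp (-(ρ.im * t)) := by
      rw [heζ, norm_mul, norm_cexp_I_mul]
      gcongr
      exact hM t ht.le
    have h2 : Real.exp (-(ρ.im * t)) ≤ 1 := by
      rw [Real.exp_le_one_iff]; linarith [mul_pos hρ ht]
    have h3 : ‖e t‖ ≤ M := h1.trans (mul_le_of_le_one_right hM0 h2)
    rw [norm_mul]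
    calc ‖Q t - ρ ^ 2‖ * ‖e t‖ ≤ (‖Q t‖ + ‖ρ ^ 2‖) * ‖e t‖ := by gcongr; exact norm_sub_le _ _
      _ = ‖e t‖ * ‖Q t‖ + ‖ρ ^ 2‖ * ‖e t‖ := by ring
      _ ≤ M * ‖Q t‖ + ‖ρ ^ 2‖ * (M * Real.exp (-(ρ.im * t))) := by gcongr
      _ = _ := by simp [mul_assoc]
  have hde0 : Tendsto de atTop (𝓝 0) := by
    have h1 := (intervalIntegral_tendsto_integral_Ioi 0 hi1 tendsto_id).add_const (de 0)
    simp only [← hint, id, sub_add_cancel] at h1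
    rwa [eq_zero_of_tendsto_deriv hde he0 h1] at h1
  set F : ℝ → ℂ := fun x => Complex.exp (Complex.I * ρ * x) * (de x - Complex.I * ρ * e x) with hF
  have hFc : Continuous F := by fun_prop
  have hF0 : Tendsto F atTop (𝓝 0) := by
    simpa using hexp0.mul (hde0.sub (he0.const_mul (Complex.I * ρ)))
  have hdF (x : ℝ) (hx : x ∉ S) :
      HasDerivAt F (Complex.exp (Complex.I * ρ * x) * (Q x * e x)) x := by
    convert! (hasDerivAt_cexp_const_mul (Complex.I * ρ) x).mul
      ((hdde x hx).sub ((hde x).const_mul (Complex.I * ρ))) using 1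
    simp only [Pi.sub_apply]
    linear_combination (ρ ^ 2 * Complex.exp (Complex.I * ρ * x) * e x) * Complex.I_sq
  have hFeq (x : ℝ) (hx : 0 ≤ x) : ‖F x * Complex.exp (-(2 * (Complex.I * ρ * x)))‖
      ≤ M * ∫ t in Ioi x, ‖Q t‖ := by
    have hb : ∀ b, x ≤ b → ‖F b - F x‖ ≤ Real.exp (-(2 * (ρ.im * x))) * (M * ∫ t in Ioi x, ‖Q t‖) := by
      intro b hxb
      have hpt : ∀ t, x < t → ‖Complex.exp (Complex.I * ρ * t) * (Q t * e t)‖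
          ≤ Real.exp (-(2 * (ρ.im * x))) * (M * ‖Q t‖) := by
        intro t ht
        rw [heζ, norm_mul, norm_mul, norm_mul, norm_cexp_I_mul]
        have h1 := hM t (hx.trans ht.le)
        have h2 : Real.exp (-(ρ.im * t)) * Real.exp (-(ρ.im * t)) ≤ Real.exp (-(2 * (ρ.im * x))) := by
          rw [← Real.exp_add, Real.exp_le_exp]
          nlinarith
        calc _ = (Real.exp (-(ρ.im * t)) * Real.exp (-(ρ.im * t))) * (‖ζ t‖ * ‖Q t‖) := by ring
          _ ≤ _ := by gcongr
      have hii : IntervalIntegrable (fun t => Complex.exp (Complex.I * ρ * t) * (Q t * e t)) volume x b :=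
        (hQ.intervalIntegrable.mul_continuousOn hec.continuousOn).continuousOn_mul (by fun_prop)
      rw [← integral_eq_of_hasDerivAt_off_countable F _ hS hFc.continuousOn
        (fun z hz => hdF z hz.2) hii, intervalIntegral.integral_of_le hxb]
      have hgi : IntegrableOn (fun t => Real.exp (-(2 * (ρ.im * x))) * (M * ‖Q t‖)) (Ioi x) :=
        ((hQ.norm.const_mul M).const_mul _).integrableOn
      have hsub : Ioc x b ⊆ Ioi x := fun t ht => ht.1
      have h1 := norm_integral_le_of_norm_le (hgi.mono_set hsub)
        ((ae_restrict_iff' measurableSet_Ioc).2 (Eventually.of_forall fun t ht => hpt t ht.1))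
      refine h1.trans ((setIntegral_mono_set hgi (Eventually.of_forall fun t => by positivity)
        hsub.eventuallyLE).trans_eq ?_)
      rw [integral_const_mul, integral_const_mul]
    have hlim : ‖F x‖ ≤ Real.exp (-(2 * (ρ.im * x))) * (M * ∫ t in Ioi x, ‖Q t‖) := by
      have h1 : Tendsto (fun b => ‖F b - F x‖) atTop (𝓝 ‖F x‖) := by
        simpa using (hF0.sub_const (F x)).norm
      refine le_of_tendsto h1 ?_
      filter_upwards [eventually_ge_atTop x] with b hbx using hb b hbx
    rw [norm_mul, Complex.norm_exp]
    have hre : (-(2 * (Complex.I * ρ * x))).re = 2 * (ρ.im * x) := by simp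
    rw [hre]
    calc _ ≤ Real.exp (-(2 * (ρ.im * x))) * (M * ∫ t in Ioi x, ‖Q t‖) * Real.exp (2 * (ρ.im * x)) := by
          gcongr
      _ = (Real.exp (-(2 * (ρ.im * x))) * Real.exp (2 * (ρ.im * x))) * (M * ∫ t in Ioi x, ‖Q t‖) := by
          ring
      _ = _ := by rw [← Real.exp_add]; simp
  have htail : Tendsto (fun x => M * ∫ t in Ioi x, ‖Q t‖) atTop (𝓝 0) := by
    have h1 : Tendsto (fun x => ∫ t in Ioi x, ‖Q t‖) atTop (𝓝 0) := by
      have h2 := intervalIntegral_tendsto_integral_Ioi 0 hQ.norm.integrableOn tendsto_id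
      have h3 := h2.const_sub (∫ t in Ioi (0 : ℝ), ‖Q t‖)
      rw [sub_self] at h3
      refine h3.congr fun x => ?_
      have := intervalIntegral.integral_Ioi_sub_Ioi' (a := 0) (b := x) hQ.norm.integrableOn
        hQ.norm.integrableOn
      simp only [id]
      linarith
    simpa using h1.const_mul M
  have hm : Tendsto (fun x : ℝ => F x * Complex.exp (-(2 * (Complex.I * ρ * x)))) atTop (𝓝 0) := by
    refine squeeze_zero_norm' ?_ htail
    filter_upwards [eventually_ge_atTop 0] with x hx using hFeq x hx
  have hfin := hm.add (hl.const_mul (Complex.I * ρ))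
  rw [zero_add, mul_one] at hfin
  refine hfin.congr fun x => ?_
  rw [hF]
  simp only
  have hE : Complex.exp (Complex.I * ρ * x) * Complex.exp (-(2 * (Complex.I * ρ * x)))
      = Complex.exp (-(Complex.I * ρ * x)) := by
    rw [← Complex.exp_add]; congr 1; ring
  rw [← hE]
  rw [hζ]
  simp only
  rw [← hE]
  ring

/-- Every right Jost solution of the Schrödinger equation comes from a right Jost solution of the
Zakharov-Shabat system. -/
theorem IsRightJostSchr.exists_isRightJostZS {q : ℝ → ℝ} (hq : PiecewiseC1 q)
    (hq2 : Integrable fun x => q x ^ 2) (hq' : Integrable (deriv q)) {ρ : ℂ} (hρ : 0 < ρ.im)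
    {e : ℝ → ℂ} (he : IsRightJostSchr (schrPotential q) ρ e) :
    ∃ n₁ n₂, IsRightJostZS q ρ n₁ n₂ ∧ ∀ x, e x = n₂ x - Complex.I * n₁ x := by
  obtain ⟨⟨de, hde, hint⟩, hl⟩ := he
  have hρ0 : ρ ≠ 0 := by rintro rfl; simp at hρ
  have hec : Continuous e := continuous_iff_continuousAt.2 fun x => (hde x).continuousAt
  have hcq : Continuous fun x => (q x : ℂ) := Complex.continuous_ofReal.comp hq.1
  have hdeq (y : ℝ) : de y = de 0 + ∫ t in (0 : ℝ)..y, (schrPotential q t - ρ ^ 2) * e t := by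
    rw [← (hint 0 y).2]; ring
  have hdec : Continuous de := by
    rw [funext hdeq]
    exact continuous_const.add (intervalIntegral.continuous_primitive (fun a b => (hint a b).1) 0)
  obtain ⟨S, hS, hd⟩ := hq.exists_countable
  have hdde (x : ℝ) (hx : x ∉ S) : HasDerivAt de ((schrPotential q x - ρ ^ 2) * e x) x := by
    rw [funext hdeq]
    refine (intervalIntegral.integral_hasDerivAt_right (hint 0 x).1 ?_ ?_).const_add _
    · exact ((((measurable_schrPotential hq.1).sub_const _).mul
        hec.measurable).stronglyMeasurable).stronglyMeasurableAtFilter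
    · have h1 := Complex.continuous_ofReal.continuousAt.comp (continuousAt_deriv_of_contDiffAt (hd x hx))
      exact ((((h1.const_mul Complex.I).neg.sub (hcq.continuousAt.pow 2)).sub
        continuousAt_const).mul hec.continuousAt)
  have hP (x : ℝ) : HasDerivAt (fun x => de x + Complex.I * q x * e x)
      ((-(q x : ℂ) ^ 2 - ρ ^ 2) * e x + Complex.I * q x * de x) x := by
    refine hasDerivAt_of_off_countable (P := fun x => de x + Complex.I * q x * e x)
      (h := fun x => (-(q x : ℂ) ^ 2 - ρ ^ 2) * e x + Complex.I * q x * de x)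
      (by fun_prop) (by fun_prop) hS (fun x hx => ?_) x
    have hqx : HasDerivAt (fun x => (q x : ℂ)) (deriv q x : ℝ) x :=
      ((hd x hx).differentiableAt (by norm_num)).hasDerivAt.ofReal_comp
    convert! (hdde x hx).add ((hqx.const_mul Complex.I).mul (hde x)) using 1
    simp only [schrPotential]
    ring
  have hld := tendsto_deriv_of_isRightJostSchr (integrable_schrPotential hq2 hq') hρ hde hdec
    (fun a b => (hint a b).2) hS hdde hl
  have hlq : Tendsto (fun x => (q x : ℂ)) atTop (𝓝 0) :=
    (Complex.continuous_ofReal.tendsto' 0 0 (by simp)).comp (tendsto_atTop_zero_of_piecewiseC1 hq hq2 hq')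
  have hlD : Tendsto (fun x : ℝ => (de x + Complex.I * q x * e x) / ρ
      * Complex.exp (-(Complex.I * ρ * x))) atTop (𝓝 Complex.I) := by
    have h1 := (hld.add ((hlq.const_mul Complex.I).mul hl)).div_const ρ
    rw [mul_zero, zero_mul, add_zero, mul_div_cancel_right₀ _ hρ0] at h1
    refine h1.congr fun x => ?_
    ring
  set D : ℝ → ℂ := fun x => (de x + Complex.I * q x * e x) / ρ with hD
  have hDe (x : ℝ) : de x = ρ * D x - Complex.I * q x * e x := by
    rw [hD]; field_simp; ring
  have hdD (x : ℝ) : HasDerivAt D (-(ρ * e x) + Complex.I * q x * D x) x := by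
    convert! (hP x).div_const ρ using 1
    rw [hDe, eq_div_iff hρ0]
    linear_combination ((q x : ℂ) ^ 2 * e x) * Complex.I_sq
  refine ⟨fun x => (Complex.I * e x - D x) / 2, fun x => (e x - Complex.I * D x) / 2,
    ⟨⟨fun x => ?_, fun x => ?_⟩, ?_, ?_⟩, fun x => ?_⟩
  · convert! (((hde x).const_mul Complex.I).sub (hdD x)).div_const 2 using 1
    rw [hDe]
    linear_combination (-(ρ * e x) / 2 + q x * e x / 2) * Complex.I_sq
  · convert! ((hde x).sub ((hdD x).const_mul Complex.I)).div_const 2 using 1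
    rw [hDe]
    linear_combination (-(ρ * D x) / 2 + q x * D x / 2) * Complex.I_sq
  · have := ((hl.const_mul Complex.I).sub hlD).div_const 2
    rw [mul_one, sub_self, zero_div] at this
    refine this.congr fun x => ?_
    ring
  · have := (hl.sub (hlD.const_mul Complex.I)).div_const 2
    rw [Complex.I_mul_I, sub_neg_eq_add, one_add_one_eq_two, div_self two_ne_zero] at this
    refine this.congr fun x => ?_
    ring
  · simp only
    linear_combination (e x / 2) * Complex.I_sq

/-- The kernel of the Levin representation of the right Jost solution, shifted to `(0, ∞)`. -/
def levinKernel (q : ℝ → ℝ) (x s : ℝ) : ℂ := (kernelU q x s : ℂ) - Complex.I * (kernelV q x s : ℂ)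

theorem levinKernel_re (q : ℝ → ℝ) (x s : ℝ) : (levinKernel q x s).re = kernelU q x s := by
  simp [levinKernel]

theorem levinKernel_im (q : ℝ → ℝ) (x s : ℝ) : (levinKernel q x s).im = -kernelV q x s := by
  simp [levinKernel]

theorem memLp_levinKernel {q σ : ℝ → ℝ} (h : IsMajorant q σ) (x : ℝ) :
    MemLp (levinKernel q x) 2 (volume.restrict (Ioi 0)) :=
  ((kernelBound_kernelU h).memLp_two_ofReal h (by norm_num) x).sub
    (((kernelBound_kernelV h).memLp_two_ofReal h (by norm_num) x).const_mul _)

theorem halfLineTransform_levinKernel {q σ : ℝ → ℝ} (h : IsMajorant q σ) (x : ℝ) {ρ : ℂ}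
    (hρ : 0 ≤ ρ.im) :
    halfLineTransform (levinKernel q x) ρ
      = halfLineTransform (fun s => (kernelU q x s : ℂ)) ρ
        - Complex.I * halfLineTransform (fun s => (kernelV q x s : ℂ)) ρ := by
  have h1 := (kernelBound_kernelU h).integrableOn_mul_cexp h x hρ
  have h2 := (kernelBound_kernelV h).integrableOn_mul_cexp h x hρ
  simp only [halfLineTransform]
  rw [← integral_const_mul, ← integral_sub h1 (h2.const_mul _)]
  congr 1; ext s
  rw [levinKernel]; ring

theorem integral_Ioi_mul_cexp (K : ℝ → ℂ) (x : ℝ) (ρ : ℂ) :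
    ∫ t in Ioi x, K t * Complex.exp (Complex.I * ρ * t)
      = Complex.exp (Complex.I * ρ * x) * halfLineTransform (fun s => K (s + x)) ρ := by
  rw [← integral_Ioi_zero_comp_add, halfLineTransform, ← integral_const_mul]
  congr 1; ext s
  rw [show Complex.I * ρ * ((s + x : ℝ) : ℂ) = Complex.I * ρ * s + Complex.I * ρ * x by
    push_cast; ring, Complex.exp_add]
  ring

theorem memLp_two_Ioi_zero_comp_add_iff {K : ℝ → ℂ} (x : ℝ) :
    MemLp (fun s => K (s + x)) 2 (volume.restrict (Ioi 0)) ↔ MemLp K 2 (volume.restrict (Ioi x)) := by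
  have hmp := (measurePreserving_add_right volume x).restrict_preimage_emb
    (measurableEmbedding_addRight x) (Ioi x)
  rw [preimage_add_const_Ioi] at hmp
  rw [← hmp.map_eq]
  exact (measurableEmbedding_addRight x).memLp_map_measure_iff.symm

theorem isRightLevinKernel_levinKernel {q σ : ℝ → ℝ} (h : IsMajorant q σ) (hq : PiecewiseC1 q)
    (hq2 : Integrable fun x => q x ^ 2) (hq' : Integrable (deriv q)) (x : ℝ) :
    IsRightLevinKernel (schrPotential q) x (fun t => levinKernel q x (t - x)) := by
  refine ⟨?_, fun ρ hρ e he => ?_⟩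
  · rw [← memLp_two_Ioi_zero_comp_add_iff]
    simpa only [add_sub_cancel_right] using memLp_levinKernel h x
  · obtain ⟨n₁, n₂, hn, hen⟩ := he.exists_isRightJostZS hq hq2 hq' hρ
    obtain ⟨h2, h1⟩ := eq_transform_of_isRightJostZS h hρ.le hn x
    rw [hen, h1, h2, integral_Ioi_mul_cexp]
    simp only [add_sub_cancel_right]
    rw [show (fun s => levinKernel q x s) = levinKernel q x from rfl,
      halfLineTransform_levinKernel h x hρ.le]
    ring

theorem MemLp.integrableOn_mul_cexp {f : ℝ → ℂ} (hf : MemLp f 2 (volume.restrict (Ioi 0))) {ρ : ℂ}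
    (hρ : 0 < ρ.im) :
    IntegrableOn (fun s : ℝ => f s * Complex.exp (Complex.I * ρ * s)) (Ioi 0) := by
  have := integrable_mul_pow_mul_cexp_neg hf (p := -(Complex.I * ρ)) (by simpa using hρ) 0
  simpa only [pow_zero, one_mul, neg_mul, neg_neg] using this

theorem IsRightLevinKernel.ae_eq {Q : ℝ → ℂ} {x : ℝ} {K K' : ℝ → ℂ}
    (hK : IsRightLevinKernel Q x K) (hK' : IsRightLevinKernel Q x K')
    (hex : ∀ ρ : ℂ, 0 < ρ.im → ∃ e, IsRightJostSchr Q ρ e) :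
    (fun s => K (s + x)) =ᵐ[volume.restrict (Ioi 0)] fun s => K' (s + x) := by
  have hm := (memLp_two_Ioi_zero_comp_add_iff x).2 hK.1
  have hm' := (memLp_two_Ioi_zero_comp_add_iff x).2 hK'.1
  have h0 := ae_eq_zero_of_halfLineTransform_eq_zero (hm.sub hm') (fun ξ => by
    set ρ : ℂ := (ξ : ℂ) + Complex.I / 2 with hρdef
    have hρ : 0 < ρ.im := by simp [hρdef]
    obtain ⟨e, he⟩ := hex ρ hρ
    have h1 := hK.2 ρ hρ e he
    rw [hK'.2 ρ hρ e he, add_right_inj, integral_Ioi_mul_cexp, integral_Ioi_mul_cexp] at h1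
    have h2 := mul_left_cancel₀ (Complex.exp_ne_zero _) h1
    rw [← sub_eq_zero.2 h2.symm]
    simp only [halfLineTransform]
    rw [← integral_sub (MemLp.integrableOn_mul_cexp hm hρ) (MemLp.integrableOn_mul_cexp hm' hρ)]
    congr 1; ext s
    simp only [Pi.sub_apply]
    ring)
  filter_upwards [h0] with s hs
  exact sub_eq_zero.1 hs

theorem integral_exp_neg_im_mul {η : ℝ} (hη : 0 < η) :
    ∫ s in Ioi (0 : ℝ), Real.exp (-(2 * η * s)) = 1 / (2 * η) := by
  have h := integral_pow_mul_cexp_neg (p := ((2 * η : ℝ) : ℂ)) (by rw [Complex.ofReal_re]; linarith) 0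
  simp only [pow_zero, one_mul, zero_add, pow_one, Nat.factorial_zero, Nat.cast_one] at h
  have h2 (s : ℝ) : Complex.exp (-(((2 * η : ℝ) : ℂ) * s)) = ((Real.exp (-(2 * η * s)) : ℝ) : ℂ) := by
    push_cast; rfl
  simp_rw [h2, integral_complex_ofReal] at h
  exact_mod_cast h

/-- The Cauchy-Schwarz estimate of the half-line transform. -/
theorem norm_halfLineTransform_le_of_eLpNorm_le {f : ℝ → ℂ}
    (hf : MemLp f 2 (volume.restrict (Ioi 0))) {T : ℝ} (hT : 0 ≤ T)
    (hfT : eLpNorm f 2 (volume.restrict (Ioi 0)) ≤ ENNReal.ofReal T) {ρ : ℂ} (hρ : 0 < ρ.im) :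
    ‖halfLineTransform f ρ‖ ≤ T / Real.sqrt (2 * ρ.im) := by
  have hgm : MemLp (fun s : ℝ => Complex.exp (-((-(Complex.I * ρ)) * s))) 2 (volume.restrict (Ioi 0)) := by
    have := memLp_two_pow_mul_cexp_neg (p := -(Complex.I * ρ)) (by simpa using hρ) 0
    simpa only [pow_zero, one_mul] using this
  have hgs := hgm.star
  set g : ℝ → ℂ := star fun s : ℝ => Complex.exp (-((-(Complex.I * ρ)) * s)) with hg
  have hgv (s : ℝ) : g s = (starRingEnd ℂ) (Complex.exp (Complex.I * ρ * s)) := by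
    simp [hg]
  have hin : inner ℂ (hgs.toLp g : HalfLineL2) (hf.toLp f) = halfLineTransform f ρ := by
    rw [L2.inner_def, halfLineTransform]
    apply integral_congr_ae
    filter_upwards [hgs.coeFn_toLp, hf.coeFn_toLp] with s h1 h2
    rw [h1, h2, RCLike.inner_apply, hgv, Complex.conj_conj]
  have hgg : ‖(hgs.toLp g : HalfLineL2)‖ ^ 2 = 1 / (2 * ρ.im) := by
    have h1 : inner ℂ (hgs.toLp g : HalfLineL2) (hgs.toLp g) = ((1 / (2 * ρ.im) : ℝ) : ℂ) := by
      rw [L2.inner_def, ← integral_exp_neg_im_mul hρ, ← integral_complex_ofReal]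
      apply integral_congr_ae
      filter_upwards [hgs.coeFn_toLp] with s h1
      rw [h1, RCLike.inner_apply, hgv, Complex.conj_conj, mul_comm, Complex.mul_conj,
        Complex.normSq_eq_norm_sq, norm_cexp_I_mul, ← Real.exp_nat_mul]
      congr 2; push_cast; ring
    rw [@norm_sq_eq_re_inner ℂ, h1]
    exact Complex.ofReal_re _
  have hgn : ‖(hgs.toLp g : HalfLineL2)‖ = 1 / Real.sqrt (2 * ρ.im) := by
    rw [← Real.sqrt_sq (norm_nonneg _), hgg, Real.sqrt_div zero_le_one, Real.sqrt_one]
  have hfn : ‖(hf.toLp f : HalfLineL2)‖ ≤ T := by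
    rw [Lp.norm_toLp]
    exact ENNReal.toReal_le_of_le_ofReal hT hfT
  rw [← hin]
  refine (norm_inner_le_norm _ _).trans ?_
  rw [hgn, one_div_mul_eq_div]
  gcongr

theorem tailNorm_nonneg (c : ℕ → ℂ) (N : ℕ) : 0 ≤ tailNorm c N := Real.sqrt_nonneg _

theorem integrableOn_laguerreFun (n : ℕ) : IntegrableOn (laguerreFun n) (Ioi 0) := by
  have hhalf : 0 < (1 / 2 : ℂ).re := by norm_num
  have : laguerreFun n = fun t => _ := funext (laguerreFun_eq_sum n)
  rw [this]
  exact integrable_finsetSum _ fun k _ => (integrableOn_pow_mul_cexp_neg hhalf k).const_mul _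

theorem integrableOn_laguerreFun_mul_cexp (n : ℕ) {ρ : ℂ} (hρ : 0 ≤ ρ.im) :
    IntegrableOn (fun s : ℝ => laguerreFun n s * Complex.exp (Complex.I * ρ * s)) (Ioi 0) := by
  refine (integrableOn_laguerreFun n).norm.mono' ?_ ?_
  · have := continuous_laguerreFun n
    exact (by fun_prop : Continuous fun s : ℝ =>
      laguerreFun n s * Complex.exp (Complex.I * ρ * s)).aestronglyMeasurable
  · filter_upwards [ae_restrict_mem measurableSet_Ioi] with s hs
    rw [norm_mul]
    exact mul_le_of_le_one_right (norm_nonneg _) (norm_cexp_I_mul_le_one hρ (le_of_lt hs))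

theorem halfLineTransform_laguerreRemainder {f : ℝ → ℂ} {ρ : ℂ} (hρ : 0 ≤ ρ.im)
    (hf : IntegrableOn (fun s : ℝ => f s * Complex.exp (Complex.I * ρ * s)) (Ioi 0))
    (c : ℕ → ℝ) (N : ℕ) :
    halfLineTransform (laguerreRemainder f (fun n => (c n : ℂ)) N) ρ
      = halfLineTransform f ρ - sppsSum c N ρ := by
  have hL : sppsSum c N ρ = ∫ s in Ioi (0 : ℝ), ∑ n ∈ Finset.range (N + 1),
      (c n : ℂ) * (laguerreFun n s * Complex.exp (Complex.I * ρ * s)) := by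
    rw [integral_finsetSum _ fun n _ => (integrableOn_laguerreFun_mul_cexp n hρ).const_mul _,
      sppsSum, Finset.mul_sum]
    refine Finset.sum_congr rfl fun n _ => ?_
    have := halfLineTransform_laguerreFun n hρ
    rw [halfLineTransform] at this
    rw [integral_const_mul, this]
    ring
  have hi : IntegrableOn (fun s : ℝ => ∑ n ∈ Finset.range (N + 1),
      (c n : ℂ) * (laguerreFun n s * Complex.exp (Complex.I * ρ * s))) (Ioi 0) :=
    integrable_finsetSum _ fun n _ => (integrableOn_laguerreFun_mul_cexp n hρ).const_mul _
  rw [hL, halfLineTransform, halfLineTransform, ← integral_sub hf hi]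
  congr 1; ext s
  rw [laguerreRemainder, sub_mul, Finset.sum_mul]
  simp only [mul_assoc]

theorem integrableOn_laguerreRemainder {f : ℝ → ℂ} (hf : IntegrableOn f (Ioi 0)) (c : ℕ → ℂ)
    (N : ℕ) : IntegrableOn (laguerreRemainder f c N) (Ioi 0) :=
  hf.sub (integrable_finsetSum _ fun n _ => (integrableOn_laguerreFun n).const_mul _)

theorem laguerreRemainder_re (f : ℝ → ℂ) (c : ℕ → ℂ) (N : ℕ) (s : ℝ) :
    laguerreRemainder (fun s => ((f s).re : ℂ)) (fun n => ((c n).re : ℂ)) N s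
      = ((laguerreRemainder f c N s).re : ℂ) := by
  obtain ⟨r, hr⟩ : ∃ r : ℕ → ℝ, ∀ n, laguerreFun n s = r n := ⟨_, fun n => rfl⟩
  simp [laguerreRemainder, hr]

theorem laguerreRemainder_im (f : ℝ → ℂ) (c : ℕ → ℂ) (N : ℕ) (s : ℝ) :
    laguerreRemainder (fun s => ((f s).im : ℂ)) (fun n => ((c n).im : ℂ)) N s
      = ((laguerreRemainder f c N s).im : ℂ) := by
  obtain ⟨r, hr⟩ : ∃ r : ℕ → ℝ, ∀ n, laguerreFun n s = r n := ⟨_, fun n => rfl⟩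
  simp [laguerreRemainder, hr]

/-- Estimates of `e^{iρx}` times the transform of a function with small `L₂` norm. -/
theorem estimates_of_eLpNorm_le {R : ℝ → ℂ} (h1 : IntegrableOn R (Ioi 0))
    (h2 : MemLp R 2 (volume.restrict (Ioi 0))) {T : ℝ} (hT : 0 ≤ T)
    (hRT : eLpNorm R 2 (volume.restrict (Ioi 0)) ≤ ENNReal.ofReal T) (x : ℝ) {G : ℂ → ℂ}
    (hG : ∀ ρ : ℂ, 0 ≤ ρ.im → G ρ = Complex.exp (Complex.I * ρ * x) * halfLineTransform R ρ) :
    (∀ ρ : ℂ, 0 < ρ.im → ‖G ρ‖ ≤ T * (Real.exp (-(ρ.im * x)) / Real.sqrt (2 * ρ.im))) ∧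
      MemLp (fun ξ : ℝ => G ξ) 2 volume ∧
      eLpNorm (fun ξ : ℝ => G ξ) 2 volume ≤ ENNReal.ofReal (Real.sqrt (2 * Real.pi) * T) := by
  refine ⟨fun ρ hρ => ?_, ?_⟩
  · rw [hG ρ hρ.le, norm_mul, norm_cexp_I_mul]
    calc _ ≤ Real.exp (-(ρ.im * x)) * (T / Real.sqrt (2 * ρ.im)) := by
          gcongr; exact norm_halfLineTransform_le_of_eLpNorm_le h2 hT hRT hρ
      _ = _ := by ring
  · obtain ⟨hm, he⟩ := memLp_eLpNorm_halfLineTransform h1 h2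
    have hGξ : (fun ξ : ℝ => G ξ) = fun ξ : ℝ => Complex.exp (Complex.I * ξ * x)
        * halfLineTransform R ξ := funext fun ξ => hG ξ (by simp)
    have hnorm (ξ : ℝ) : ‖Complex.exp (Complex.I * ξ * x) * halfLineTransform R ξ‖
        = ‖halfLineTransform R ξ‖ := by
      rw [norm_mul, norm_cexp_I_mul]; simp
    rw [hGξ]
    refine ⟨hm.congr_norm ?_ (Eventually.of_forall fun ξ => (hnorm ξ).symm), ?_⟩
    · exact (by fun_prop : Continuous fun ξ : ℝ =>
        Complex.exp (Complex.I * ξ * x)).aestronglyMeasurable.mul hm.1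
    · rw [eLpNorm_congr_norm_ae (Eventually.of_forall hnorm), he,
        ENNReal.ofReal_mul (Real.sqrt_nonneg _)]
      gcongr

/-- Fourier-Laguerre approximation of the right Jost solution. -/
theorem right_estimates {q σ : ℝ → ℝ} (h : IsMajorant q σ) {ψ₁ ψ₂ : ℂ → ℝ → ℂ}
    (hψ : ∀ ρ : ℂ, 0 ≤ ρ.im → IsRightJostZS q ρ (ψ₁ ρ) (ψ₂ ρ)) (x : ℝ) {c : ℕ → ℂ}
    (hc : ∀ n, c n = ∫ s in Ioi (0 : ℝ), levinKernel q x s * laguerreFun n s) (N : ℕ) :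
    ((∀ ρ : ℂ, 0 < ρ.im →
        ‖ψ₁ ρ x + Complex.exp (Complex.I * ρ * x) * sppsSum (fun n => (c n).im) N ρ‖
          ≤ tailNorm c N * (Real.exp (-(ρ.im * x)) / Real.sqrt (2 * ρ.im))) ∧
      MemLp (fun ξ : ℝ => ψ₁ ξ x
        + Complex.exp (Complex.I * ξ * x) * sppsSum (fun n => (c n).im) N ξ) 2 volume ∧
      eLpNorm (fun ξ : ℝ => ψ₁ ξ x
        + Complex.exp (Complex.I * ξ * x) * sppsSum (fun n => (c n).im) N ξ) 2 volume
          ≤ ENNReal.ofReal (Real.sqrt (2 * Real.pi) * tailNorm c N)) ∧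
    ((∀ ρ : ℂ, 0 < ρ.im →
        ‖ψ₂ ρ x - Complex.exp (Complex.I * ρ * x) * (1 + sppsSum (fun n => (c n).re) N ρ)‖
          ≤ tailNorm c N * (Real.exp (-(ρ.im * x)) / Real.sqrt (2 * ρ.im))) ∧
      MemLp (fun ξ : ℝ => ψ₂ ξ x
        - Complex.exp (Complex.I * ξ * x) * (1 + sppsSum (fun n => (c n).re) N ξ)) 2 volume ∧
      eLpNorm (fun ξ : ℝ => ψ₂ ξ x
        - Complex.exp (Complex.I * ξ * x) * (1 + sppsSum (fun n => (c n).re) N ξ)) 2 volume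
          ≤ ENNReal.ofReal (Real.sqrt (2 * Real.pi) * tailNorm c N)) := by
  have hU := kernelBound_kernelU h
  have hV := kernelBound_kernelV h
  have hk := memLp_levinKernel h x
  have hkr := memLp_laguerreRemainder hk c N
  have hkn := (eLpNorm_laguerreRemainder hk hc N).le
  have hle {R : ℝ → ℂ} (hR : ∀ s, ‖R s‖ ≤ ‖laguerreRemainder (levinKernel q x) c N s‖) :
      eLpNorm R 2 (volume.restrict (Ioi 0)) ≤ ENNReal.ofReal (tailNorm c N) :=
    (eLpNorm_mono hR).trans hkn
  constructor
  · have hUi : (fun s => ((levinKernel q x s).im : ℂ)) = fun s => ((-kernelV q x s : ℝ) : ℂ) := by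
      ext s; rw [levinKernel_im]
    have hi1 : IntegrableOn (fun s => ((levinKernel q x s).im : ℂ)) (Ioi 0) := by
      rw [hUi]; simpa using (hV.integrableOn_ofReal h x).neg
    have hi2 : MemLp (fun s => ((levinKernel q x s).im : ℂ)) 2 (volume.restrict (Ioi 0)) := by
      rw [hUi]; simpa using! (hV.memLp_two_ofReal h (by norm_num) x).neg
    have hr1 := integrableOn_laguerreRemainder hi1 (fun n => ((c n).im : ℂ)) N
    have hr2 := memLp_laguerreRemainder hi2 (fun n => ((c n).im : ℂ)) N
    have hr3 := hle (R := laguerreRemainder (fun s => ((levinKernel q x s).im : ℂ))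
      (fun n => ((c n).im : ℂ)) N) (fun s => by
        rw [laguerreRemainder_im, Complex.norm_real]; exact Complex.abs_im_le_norm _)
    refine estimates_of_eLpNorm_le hr1.neg hr2.neg (tailNorm_nonneg c N)
      (by rw [eLpNorm_neg]; exact hr3) x (G := fun ρ => ψ₁ ρ x
        + Complex.exp (Complex.I * ρ * x) * sppsSum (fun n => (c n).im) N ρ) (fun ρ hρ => ?_)
    have hint := hV.integrableOn_mul_cexp h x hρ
    have hint' : IntegrableOn (fun s : ℝ => ((levinKernel q x s).im : ℂ)
        * Complex.exp (Complex.I * ρ * s)) (Ioi 0) := by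
      refine hint.neg.congr (Eventually.of_forall fun s => ?_)
      simp [levinKernel_im]
    have h3 := halfLineTransform_laguerreRemainder hρ hint' (fun n => (c n).im) N
    have h4 : halfLineTransform (fun s => ((levinKernel q x s).im : ℂ)) ρ
        = -halfLineTransform (fun s => (kernelV q x s : ℂ)) ρ := by
      rw [hUi, halfLineTransform, halfLineTransform, ← integral_neg]
      congr 1; ext s; push_cast; ring
    have h5 : halfLineTransform (-laguerreRemainder (fun s => ((levinKernel q x s).im : ℂ))
        (fun n => ((c n).im : ℂ)) N) ρ = -halfLineTransform (laguerreRemainder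
          (fun s => ((levinKernel q x s).im : ℂ)) (fun n => ((c n).im : ℂ)) N) ρ := by
      rw [halfLineTransform, halfLineTransform, ← integral_neg]
      congr 1; ext s; simp
    rw [h5, h3, h4, (eq_transform_of_isRightJostZS h hρ (hψ ρ hρ) x).2]
    ring
  · have hUi : (fun s => ((levinKernel q x s).re : ℂ)) = fun s => (kernelU q x s : ℂ) := by
      ext s; rw [levinKernel_re]
    have hr1 := integrableOn_laguerreRemainder (hU.integrableOn_ofReal h x) (fun n => ((c n).re : ℂ)) N
    have hr2 := memLp_laguerreRemainder (hU.memLp_two_ofReal h (by norm_num) x)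
      (fun n => ((c n).re : ℂ)) N
    have hr3 := hle (R := laguerreRemainder (fun s => (kernelU q x s : ℂ))
      (fun n => ((c n).re : ℂ)) N) (fun s => by
        rw [← hUi, laguerreRemainder_re, Complex.norm_real]; exact Complex.abs_re_le_norm _)
    refine estimates_of_eLpNorm_le hr1 hr2 (tailNorm_nonneg c N) hr3 x (G := fun ρ => ψ₂ ρ x
        - Complex.exp (Complex.I * ρ * x) * (1 + sppsSum (fun n => (c n).re) N ρ)) (fun ρ hρ => ?_)
    have h3 := halfLineTransform_laguerreRemainder hρ (hU.integrableOn_mul_cexp h x hρ)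
      (fun n => (c n).re) N
    rw [h3, (eq_transform_of_isRightJostZS h hρ (hψ ρ hρ) x).1]
    ring

/-- The Fourier-Laguerre coefficients of any right Levin kernel. -/
theorem integral_levinKernel_eq {q : ℝ → ℝ} (hq : PiecewiseC1 q)
    (hq2 : ClassL11 fun x => q x ^ 2) (hq' : ClassL11 (deriv q)) {ψ₁ ψ₂ : ℂ → ℝ → ℂ}
    (hψ : ∀ ρ : ℂ, 0 ≤ ρ.im → IsRightJostZS q ρ (ψ₁ ρ) (ψ₂ ρ)) (x : ℝ) {K : ℝ → ℂ}
    (hK : IsRightLevinKernel (schrPotential q) x K) (n : ℕ) :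
    ∫ s in Ioi (0 : ℝ), K (s + x) * laguerreFun n s
      = ∫ s in Ioi (0 : ℝ), levinKernel q x s * laguerreFun n s := by
  have h := isMajorant_derivTail hq hq2 hq'
  have hae := hK.ae_eq (isRightLevinKernel_levinKernel h hq hq2.integrable hq'.integrable x)
    (fun ρ hρ => ⟨_, (hψ ρ hρ.le).isRightJostSchr hq hq2.integrable hq'.integrable⟩)
  apply integral_congr_ae
  filter_upwards [hae] with s hs
  rw [hs, add_sub_cancel_right]

theorem coeffA_eq {q : ℝ → ℝ} (hq : PiecewiseC1 q)
    (hq2 : ClassL11 fun x => q x ^ 2) (hq' : ClassL11 (deriv q)) {ψ₁ ψ₂ : ℂ → ℝ → ℂ}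
    (hψ : ∀ ρ : ℂ, 0 ≤ ρ.im → IsRightJostZS q ρ (ψ₁ ρ) (ψ₂ ρ)) (x : ℝ) (n : ℕ) :
    coeffA q n x = ∫ s in Ioi (0 : ℝ), levinKernel q x s * laguerreFun n s := by
  have hK : IsRightLevinKernel (schrPotential q) x (rightLevinKernel (schrPotential q) x) :=
    Classical.epsilon_spec ⟨_, isRightLevinKernel_levinKernel (isMajorant_derivTail hq hq2 hq') hq
      hq2.integrable hq'.integrable x⟩
  rw [← integral_levinKernel_eq hq hq2 hq' hψ x hK, coeffA, laguerreA, ← integral_Ioi_zero_comp_add]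
  congr 1; ext s
  rw [laguerreFun, add_sub_cancel_right, show x - (s + x) = -s by ring]

/-- The reflected potential `-q(-x)`. -/
def reflectPotential (q : ℝ → ℝ) (x : ℝ) : ℝ := -q (-x)

theorem deriv_reflectPotential (q : ℝ → ℝ) (x : ℝ) :
    deriv (reflectPotential q) x = deriv q (-x) := by
  have : reflectPotential q = fun x => -(fun y => q (-y)) x := rfl
  rw [this, deriv.fun_neg, deriv_comp_neg, neg_neg]

theorem schrPotential_reflectPotential (q : ℝ → ℝ) (x : ℝ) :
    schrPotential (reflectPotential q) x = schrPotential q (-x) := by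
  simp [schrPotential, deriv_reflectPotential, reflectPotential]

theorem PiecewiseC1.reflect {q : ℝ → ℝ} (hq : PiecewiseC1 q) : PiecewiseC1 (reflectPotential q) := by
  obtain ⟨hc, S, hS, hd⟩ := hq
  refine ⟨(hc.comp continuous_neg).neg, -S, fun R => ?_, fun x hx => ?_⟩
  · have : -S ∩ Icc (-R) R = -(S ∩ Icc (-R) R) := by
      rw [Set.inter_neg, Set.neg_Icc, neg_neg]
    rw [this]
    exact (hS R).neg
  · have h1 : ContDiffAt ℝ 1 q (-x) := hd (-x) hx
    exact (ContDiffAt.comp x h1 contDiffAt_id.neg).neg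

theorem ClassL11.comp_neg {E : Type*} [NormedAddCommGroup E] {f : ℝ → E} (hf : ClassL11 f) :
    ClassL11 fun x => f (-x) := by
  refine ⟨hf.1.comp_quasiMeasurePreserving
    (Measure.measurePreserving_neg volume).quasiMeasurePreserving, ?_⟩
  have := hf.2.comp_neg
  simpa only [abs_neg] using this

theorem IsLeftJostZS.reflect {q : ℝ → ℝ} {ρ : ℂ} {φ₁ φ₂ : ℝ → ℂ} (h : IsLeftJostZS q ρ φ₁ φ₂) :
    IsRightJostZS (reflectPotential q) ρ (fun x => -φ₂ (-x)) (fun x => φ₁ (-x)) := by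
  obtain ⟨⟨hd1, hd2⟩, hl1, hl2⟩ := h
  have hneg (f f' : ℝ → ℂ) (hf : ∀ x, HasDerivAt f (f' x) x) (x : ℝ) :
      HasDerivAt (fun x => f (-x)) (-f' (-x)) x := by
    have := (hf (-x)).scomp x (hasDerivAt_neg x)
    simpa using! this
  refine ⟨⟨fun x => ?_, fun x => ?_⟩, ?_, ?_⟩
  · convert! (hneg _ _ hd2 x).neg using 1
    simp only [reflectPotential]; push_cast; ring
  · convert! hneg _ _ hd1 x using 1
    simp only [reflectPotential]; push_cast; ring
  · have := (hl2.comp tendsto_neg_atTop_atBot).neg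
    rw [neg_zero] at this
    refine this.congr fun x => ?_
    simp
  · refine (hl1.comp tendsto_neg_atTop_atBot).congr fun x => ?_
    simp

theorem IsSchrSolution.reflect {Q : ℝ → ℂ} {ρ : ℂ} {y : ℝ → ℂ} (h : IsSchrSolution Q ρ y) :
    IsSchrSolution (fun x => Q (-x)) ρ (fun x => y (-x)) := by
  obtain ⟨dy, hd, hi⟩ := h
  refine ⟨fun x => -dy (-x), fun x => ?_, fun a b => ⟨?_, ?_⟩⟩
  · have := (hd (-x)).scomp x (hasDerivAt_neg x)
    simpa using! this
  · have := (IntervalIntegrable.iff_comp_neg).mp (hi (-a) (-b)).1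
    simpa using this
  · have h1 := (hi (-b) (-a)).2
    rw [← intervalIntegral.integral_comp_neg (fun t => (Q t - ρ ^ 2) * y t)] at h1
    rw [← h1]; ring

theorem IsRightJostSchr.reflect {Q : ℝ → ℂ} {ρ : ℂ} {y : ℝ → ℂ} (h : IsRightJostSchr Q ρ y) :
    IsLeftJostSchr (fun x => Q (-x)) ρ (fun x => y (-x)) := by
  refine ⟨h.1.reflect, (h.2.comp tendsto_neg_atBot_atTop).congr fun x => ?_⟩
  simp

theorem IsLeftJostSchr.reflect {Q : ℝ → ℂ} {ρ : ℂ} {y : ℝ → ℂ} (h : IsLeftJostSchr Q ρ y) :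
    IsRightJostSchr (fun x => Q (-x)) ρ (fun x => y (-x)) := by
  refine ⟨h.1.reflect, (h.2.comp tendsto_neg_atTop_atBot).congr fun x => ?_⟩
  simp

theorem memLp_two_comp_neg {K : ℝ → ℂ} {x : ℝ} (hK : MemLp K 2 (volume.restrict (Iio x))) :
    MemLp (fun t => K (-t)) 2 (volume.restrict (Ioi (-x))) := by
  have hmp := (Measure.measurePreserving_neg (volume : Measure ℝ)).restrict_preimage_emb
    (MeasurableEquiv.neg ℝ).measurableEmbedding (Iio x)
  rw [Set.neg_preimage, Set.neg_Iio] at hmp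
  exact hK.comp_measurePreserving hmp

theorem memLp_two_comp_neg' {K : ℝ → ℂ} {x : ℝ} (hK : MemLp K 2 (volume.restrict (Ioi x))) :
    MemLp (fun t => K (-t)) 2 (volume.restrict (Iio (-x))) := by
  have hmp := (Measure.measurePreserving_neg (volume : Measure ℝ)).restrict_preimage_emb
    (MeasurableEquiv.neg ℝ).measurableEmbedding (Ioi x)
  rw [Set.neg_preimage, Set.neg_Ioi] at hmp
  exact hK.comp_measurePreserving hmp

theorem integral_Iio_eq_integral_Ioi_neg (f : ℝ → ℂ) (x : ℝ) :
    ∫ t in Iio x, f t = ∫ t in Ioi (-x), f (-t) := by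
  rw [integral_comp_neg_Ioi, neg_neg, integral_Iic_eq_integral_Iio]

theorem IsLeftLevinKernel.reflect {Q : ℝ → ℂ} {x : ℝ} {K : ℝ → ℂ} (h : IsLeftLevinKernel Q x K) :
    IsRightLevinKernel (fun x => Q (-x)) (-x) (fun t => K (-t)) := by
  refine ⟨memLp_two_comp_neg h.1, fun ρ hρ e he => ?_⟩
  have he' := he.reflect
  simp only [neg_neg] at he'
  have := h.2 ρ hρ _ he'
  rw [this, integral_Iio_eq_integral_Ioi_neg]
  simp

theorem IsRightLevinKernel.reflect {Q : ℝ → ℂ} {x : ℝ} {K : ℝ → ℂ} (h : IsRightLevinKernel Q x K) :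
    IsLeftLevinKernel (fun x => Q (-x)) (-x) (fun t => K (-t)) := by
  refine ⟨memLp_two_comp_neg' h.1, fun ρ hρ e he => ?_⟩
  have he' := he.reflect
  simp only [neg_neg] at he'
  have := h.2 ρ hρ _ he'
  rw [this, integral_Iio_eq_integral_Ioi_neg]
  simp

theorem coeffB_eq {q : ℝ → ℝ} (hq : PiecewiseC1 q)
    (hq2 : ClassL11 fun x => q x ^ 2) (hq' : ClassL11 (deriv q)) {φ₁ φ₂ : ℂ → ℝ → ℂ}
    (hφ : ∀ ρ : ℂ, 0 ≤ ρ.im → IsLeftJostZS q ρ (φ₁ ρ) (φ₂ ρ)) (x : ℝ) (n : ℕ) :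
    coeffB q n x
      = ∫ s in Ioi (0 : ℝ), levinKernel (reflectPotential q) (-x) s * laguerreFun n s := by
  have hr := hq.reflect
  have hr2 : ClassL11 fun x => reflectPotential q x ^ 2 := by
    simpa [reflectPotential] using hq2.comp_neg
  have hr' : ClassL11 (deriv (reflectPotential q)) := by
    simpa only [funext (deriv_reflectPotential q)] using hq'.comp_neg
  have hQ : (fun x => schrPotential (reflectPotential q) (-x)) = schrPotential q := by
    ext x; rw [schrPotential_reflectPotential, neg_neg]
  have hK : IsLeftLevinKernel (schrPotential q) x (leftLevinKernel (schrPotential q) x) := by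
    have h1 := (isRightLevinKernel_levinKernel (isMajorant_derivTail hr hr2 hr') hr
      hr2.integrable hr'.integrable (-x)).reflect
    rw [hQ, neg_neg] at h1
    exact Classical.epsilon_spec ⟨_, h1⟩
  have hK' := hK.reflect
  rw [show (fun x => schrPotential q (-x)) = schrPotential (reflectPotential q) from
    funext fun x => (schrPotential_reflectPotential q x).symm] at hK'
  rw [← integral_levinKernel_eq hr hr2 hr' (fun ρ hρ => (hφ ρ hρ).reflect) (-x) hK' n, coeffB,
    laguerreB, integral_Iio_eq_integral_Ioi_neg, ← integral_Ioi_zero_comp_add]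
  congr 1; ext s
  rw [laguerreFun, show x - -(s + -x) = s by ring]

end ZS

end

theorem theorem3 (q : ℝ → ℝ) (hq : ZS.PiecewiseC1 q)
    (hq2 : ZS.ClassL11 (fun x => q x ^ 2)) (hq' : ZS.ClassL11 (deriv q))
    (φ₁ φ₂ ψ₁ ψ₂ : ℂ → ℝ → ℂ)
    (hφ : ∀ ρ : ℂ, 0 ≤ ρ.im → ZS.IsLeftJostZS q ρ (φ₁ ρ) (φ₂ ρ))
    (hψ : ∀ ρ : ℂ, 0 ≤ ρ.im → ZS.IsRightJostZS q ρ (ψ₁ ρ) (ψ₂ ρ))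
    (x : ℝ) :
    -- the sums that define the error quantities converge
    Summable (fun n => ‖ZS.coeffB q n x‖ ^ 2) ∧ Summable (fun n => ‖ZS.coeffA q n x‖ ^ 2) ∧
    ∀ N : ℕ,
      -- pointwise estimates in the open upper half-plane
      (∀ ρ : ℂ, 0 < ρ.im →
        ‖φ₁ ρ x - ZS.phi1N q N ρ x‖ ≤
            ZS.tailNorm (fun n => ZS.coeffB q n x) N
              * (Real.exp (ρ.im * x) / Real.sqrt (2 * ρ.im)) ∧
        ‖φ₂ ρ x - ZS.phi2N q N ρ x‖ ≤
            ZS.tailNorm (fun n => ZS.coeffB q n x) N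
              * (Real.exp (ρ.im * x) / Real.sqrt (2 * ρ.im)) ∧
        ‖ψ₁ ρ x - ZS.psi1N q N ρ x‖ ≤
            ZS.tailNorm (fun n => ZS.coeffA q n x) N
              * (Real.exp (-(ρ.im * x)) / Real.sqrt (2 * ρ.im)) ∧
        ‖ψ₂ ρ x - ZS.psi2N q N ρ x‖ ≤
            ZS.tailNorm (fun n => ZS.coeffA q n x) N
              * (Real.exp (-(ρ.im * x)) / Real.sqrt (2 * ρ.im))) ∧
      -- mean square estimates on the real axis
      (MemLp (fun ρ : ℝ => φ₁ (ρ : ℂ) x - ZS.phi1N q N (ρ : ℂ) x) 2 volume ∧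
        eLpNorm (fun ρ : ℝ => φ₁ (ρ : ℂ) x - ZS.phi1N q N (ρ : ℂ) x) 2 volume ≤
          ENNReal.ofReal
            (Real.sqrt (2 * Real.pi) * ZS.tailNorm (fun n => ZS.coeffB q n x) N)) ∧
      (MemLp (fun ρ : ℝ => φ₂ (ρ : ℂ) x - ZS.phi2N q N (ρ : ℂ) x) 2 volume ∧
        eLpNorm (fun ρ : ℝ => φ₂ (ρ : ℂ) x - ZS.phi2N q N (ρ : ℂ) x) 2 volume ≤
          ENNReal.ofReal
            (Real.sqrt (2 * Real.pi) * ZS.tailNorm (fun n => ZS.coeffB q n x) N)) ∧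
      (MemLp (fun ρ : ℝ => ψ₁ (ρ : ℂ) x - ZS.psi1N q N (ρ : ℂ) x) 2 volume ∧
        eLpNorm (fun ρ : ℝ => ψ₁ (ρ : ℂ) x - ZS.psi1N q N (ρ : ℂ) x) 2 volume ≤
          ENNReal.ofReal
            (Real.sqrt (2 * Real.pi) * ZS.tailNorm (fun n => ZS.coeffA q n x) N)) ∧
      (MemLp (fun ρ : ℝ => ψ₂ (ρ : ℂ) x - ZS.psi2N q N (ρ : ℂ) x) 2 volume ∧
        eLpNorm (fun ρ : ℝ => ψ₂ (ρ : ℂ) x - ZS.psi2N q N (ρ : ℂ) x) 2 volume ≤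
          ENNReal.ofReal
            (Real.sqrt (2 * Real.pi) * ZS.tailNorm (fun n => ZS.coeffA q n x) N)) := by
  have hr := hq.reflect
  have hr2 : ZS.ClassL11 fun x => ZS.reflectPotential q x ^ 2 := by
    simpa [ZS.reflectPotential] using hq2.comp_neg
  have hr' : ZS.ClassL11 (deriv (ZS.reflectPotential q)) := by
    simpa only [funext (ZS.deriv_reflectPotential q)] using hq'.comp_neg
  have hA := ZS.coeffA_eq hq hq2 hq' hψ x
  have hB := ZS.coeffB_eq hq hq2 hq' hφ x
  have hmR := ZS.isMajorant_derivTail hq hq2 hq'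
  have hmL := ZS.isMajorant_derivTail hr hr2 hr'
  refine ⟨ZS.summable_norm_sq_laguerre_coeff (ZS.memLp_levinKernel hmL (-x)) hB,
    ZS.summable_norm_sq_laguerre_coeff (ZS.memLp_levinKernel hmR x) hA, fun N => ?_⟩
  obtain ⟨⟨r1, r1m, r1n⟩, r2, r2m, r2n⟩ := ZS.right_estimates hmR hψ x hA N
  obtain ⟨⟨l2, l2m, l2n⟩, l1, l1m, l1n⟩ :=
    ZS.right_estimates (ψ₁ := fun ρ x => -φ₂ ρ (-x)) (ψ₂ := fun ρ x => φ₁ ρ (-x)) hmL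
      (fun ρ hρ => (hφ ρ hρ).reflect) (-x) hB N
  have e1 (ρ : ℂ) : φ₁ ρ (- -x) - Complex.exp (Complex.I * ρ * (-x : ℝ))
      * (1 + ZS.sppsSum (fun n => (ZS.coeffB q n x).re) N ρ) = φ₁ ρ x - ZS.phi1N q N ρ x := by
    rw [ZS.phi1N, neg_neg]; push_cast; rw [mul_neg]
  have e2 (ρ : ℂ) : -φ₂ ρ (- -x) + Complex.exp (Complex.I * ρ * (-x : ℝ))
      * ZS.sppsSum (fun n => (ZS.coeffB q n x).im) N ρ = -(φ₂ ρ x - ZS.phi2N q N ρ x) := by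
    rw [ZS.phi2N, neg_neg]; push_cast; rw [mul_neg]; ring
  have e3 (ρ : ℂ) : ψ₁ ρ x + Complex.exp (Complex.I * ρ * x)
      * ZS.sppsSum (fun n => (ZS.coeffA q n x).im) N ρ = ψ₁ ρ x - ZS.psi1N q N ρ x := by
    rw [ZS.psi1N]; ring
  simp only [e1] at l1 l1m l1n
  simp only [e2, norm_neg] at l2 l2m l2n
  simp only [e3] at r1 r1m r1n
  have hexp (ρ : ℂ) : Real.exp (-(ρ.im * -x)) = Real.exp (ρ.im * x) := by rw [mul_neg, neg_neg]
  simp only [hexp] at l1 l2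
  refine ⟨fun ρ hρ => ⟨l1 ρ hρ, l2 ρ hρ, r1 ρ hρ, r2 ρ hρ⟩, ⟨l1m, l1n⟩, ⟨?_, ?_⟩, ⟨r1m, r1n⟩,
    r2m, r2n⟩
  · convert! l2m.neg using 1
    funext ξ
    simp only [Pi.neg_apply, neg_neg]
  · rw [← eLpNorm_neg]
    exact l2n
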